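/- Let $\mathbb K\in\{\mathbb R,\mathbb C\}$, and let $G$ and $N$ be Lie groups over $\mathbb K$ modelled on (Hausdorff) locally convex spaces, where smoothness is understood as follows: a map on an open set is $C^1$ if it is continuous and has directional derivatives $df(x)(h)$ depending continuously on $(x,h)$, it is $C^n$ if moreover $df$ is $C^{n-1}$, and it is smooth if it is $C^n$ for all $n$. A *smooth factor system* for $(G,N)$ is a pair $(S,\omega)$ of maps $S\colon G\to \operatorname{Aut}(N)$ (Lie group automorphisms) and $\omega\colon G\times G\to N$ such that - $S(1)=\mathrm{id}_N$, and $(g,n)\mapsto S(g)(n)$ is smooth on $U\times N$ for some open identity neighbourhood $U\subseteq G$; - $\omega(g,1)=\omega(1,g)=1$ for all $g$, $\omega$ is smooth on an identity neighbourhood of $G\times G$, and for each $g\in G$ the map $x\mapsto\omega(g,x)\,\omega(gxg^{-1},g)^{-1}$ is smooth on an identity neighbourhood of $G$; - $S(g)S(g')S(gg')^{-1}=C_N(\omega(g,g'))$, where $C_N(n)(n')=nn'n^{-1}$, and $S(g)(\omega(g',g''))\,\omega(g,g'g'')\,\omega(gg',g'')^{-1}\,\omega(g,g')^{-1}=1$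 for all $g,g',g''\in G$. For such a pair, $N\times_{(S,\omega)}G$ denotes the set $N\times G$ with the group multiplication $(n,g)(n',g')=(n\,S(g)(n')\,\omega(g,g'),\,gg')$. An *extension of Lie groups* of $G$ by $N$ is a short exact sequence $1\to N\xrightarrow{\iota}\widehat G\xrightarrow{q}G\to1$ of smooth homomorphisms of Lie groups for which $q$ is a locally trivial smooth $N$-principal bundle. Two extensions are *equivalent* if there is an isomorphism of Lie groups between the middle groups commuting with the maps from $N$ and to $G$. (1) Let $(S,\omega)$ be a smooth factor system. Then $N\times_{(S,\omega)}G$ carries a unique Lie group structure for which there is an open identity neighbourhood $U\subseteq G$ such that the identity map $N\times G\to N\times_{(S,\omega)}G$ restricts to a diffeomorphism of $N\times U$ onto an open subset. With this structure, $q(n,g)=g$ and $\iota(n)=(n,1)$ define an extension of Lie groups of $G$ by $N$. It is also the only Lie group structure on $N\times_{(S,\omega)}G$ for which the identity map is smooth on $N\times U$ for some open identity neighbourhood $U\subseteq G$ and for which $(\iota,q)$ is an extension of Lie groups of $G$ by $N$. (Lie group structures are compared without fixing the model space; two are the same if the identity is a diffeomorphism.) (2) Conversely, let $N\xrightarrow{\iota}\widehat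 G\xrightarrow{q}G$ be an extension of Lie groups. Then there is a section $\sigma\colon G\to\widehat G$ of $q$ with $\sigma(1)=1$ that is smooth on an identity neighbourhood. For every such $\sigma$, let $S(g)\in\operatorname{Aut}(N)$ be given by $\iota(S(g)(n))=\sigma(g)\iota(n)\sigma(g)^{-1}$, and $\omega=\delta_\sigma$ by $\iota(\omega(g,g'))=\sigma(g)\sigma(g')\sigma(gg')^{-1}$. Then $(S,\omega)$ is a smooth factor system, and the given extension is equivalent to $N\times_{(S,\omega)}G$ with the Lie group structure from (1). -/

import Mathlib

open Set Filter Topology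

namespace LCLie

/-! ### Calculus in locally convex spaces -/

/-- Hausdorff locally convex topological vector spaces over `𝕜 = ℝ` or `ℂ`. -/
class LocallyConvexTVS (𝕜 E : Type*) [RCLike 𝕜] [AddCommGroup E] [Module 𝕜 E]
    [TopologicalSpace E] : Prop extends
    IsTopologicalAddGroup E, ContinuousSMul 𝕜 E, T2Space E where
  locallyConvex :
    letI : Module ℝ E := Module.compHom E (algebraMap ℝ 𝕜)
    LocallyConvexSpace ℝ E

instance {𝕜 E F : Type*} [RCLike 𝕜] [AddCommGroup E] [Module 𝕜 E] [TopologicalSpace E]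
    [LocallyConvexTVS 𝕜 E] [AddCommGroup F] [Module 𝕜 F] [TopologicalSpace F]
    [LocallyConvexTVS 𝕜 F] : LocallyConvexTVS 𝕜 (E × F) where
  locallyConvex := by
    let : Module ℝ E := Module.compHom E (algebraMap ℝ 𝕜)
    let : Module ℝ F := Module.compHom F (algebraMap ℝ 𝕜)
    have : LocallyConvexSpace ℝ E := LocallyConvexTVS.locallyConvex (𝕜 := 𝕜)
    have : LocallyConvexSpace ℝ F := LocallyConvexTVS.locallyConvex (𝕜 := 𝕜)
    exact (inferInstance : LocallyConvexSpace ℝ (E × F))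

/-- `y` is the derivative of `f` at `x` in the direction `h`:
`y = lim_{t → 0} (f (x + t h) - f x) / t`. -/
def HasDirDeriv (𝕜 : Type*) {E F : Type*} [RCLike 𝕜] [AddCommGroup E] [Module 𝕜 E]
    [AddCommGroup F] [Module 𝕜 F] [TopologicalSpace F] (f : E → F) (x h : E) (y : F) : Prop :=
  Tendsto (fun t : 𝕜 => t⁻¹ • (f (x + t • h) - f x)) (𝓝[≠] 0) (𝓝 y)

/-- `f` is a `C^n`-map on the open set `U`: it is continuous on `U`, and if `n ≥ 1` then all
directional derivatives `df(x)(h)`, `x ∈ U`, exist and `df : U × E → F` is a `C^(n-1)`-map. -/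
def CnOn (𝕜 : Type*) [RCLike 𝕜] {F : Type*} [AddCommGroup F] [Module 𝕜 F] [TopologicalSpace F] :
    (n : ℕ) → {E : Type*} → [AddCommGroup E] → [Module 𝕜 E] → [TopologicalSpace E] →
      (f : E → F) → (U : Set E) → Prop
  | 0, _, _, _, _, f, U => ContinuousOn f U
  | n + 1, E, _, _, _, f, U =>
      ContinuousOn f U ∧ ∃ df : E × E → F,
        (∀ x ∈ U, ∀ h, HasDirDeriv 𝕜 f x h (df (x, h))) ∧ CnOn 𝕜 n df (U ×ˢ univ)

/-- `f` is smooth (`C^∞`) on the open set `U`. -/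
def SmoothOn (𝕜 : Type*) [RCLike 𝕜] {E F : Type*} [AddCommGroup E] [Module 𝕜 E]
    [TopologicalSpace E] [AddCommGroup F] [Module 𝕜 F] [TopologicalSpace F]
    (f : E → F) (U : Set E) : Prop :=
  ∀ n : ℕ, CnOn 𝕜 n f U

/-! ### Manifolds and Lie groups modelled on locally convex spaces -/

/-- The product of two charted spaces, with the product charts, modelled on `E × E'`. -/
instance prodCharted (E M E' M' : Type*) [TopologicalSpace E] [TopologicalSpace M]
    [ChartedSpace E M] [TopologicalSpace E'] [TopologicalSpace M'] [ChartedSpace E' M'] :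
    ChartedSpace (E × E') (M × M') :=
  prodChartedSpace E M E' M'

/-- The map `f` between charted spaces is smooth on the open set `s`: it is continuous on `s`
and smooth there in all charts. -/
def MSmoothOn (𝕜 E E' : Type*) [RCLike 𝕜] [AddCommGroup E] [Module 𝕜 E] [TopologicalSpace E]
    [AddCommGroup E'] [Module 𝕜 E'] [TopologicalSpace E'] {M M' : Type*}
    [tM : TopologicalSpace M] [cM : ChartedSpace E M]
    [tM' : TopologicalSpace M'] [cM' : ChartedSpace E' M'] (f : M → M') (s : Set M) : Prop :=
  ContinuousOn f s ∧ ∀ e ∈ atlas E M, ∀ e' ∈ atlas E' M',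
    SmoothOn 𝕜 (e' ∘ f ∘ e.symm) (e.target ∩ e.symm ⁻¹' (s ∩ f ⁻¹' e'.source))

/-- `f` is smooth. -/
def MSmooth (𝕜 E E' : Type*) [RCLike 𝕜] [AddCommGroup E] [Module 𝕜 E] [TopologicalSpace E]
    [AddCommGroup E'] [Module 𝕜 E'] [TopologicalSpace E'] {M M' : Type*}
    [tM : TopologicalSpace M] [cM : ChartedSpace E M]
    [tM' : TopologicalSpace M'] [cM' : ChartedSpace E' M'] (f : M → M') : Prop :=
  MSmoothOn 𝕜 E E' f univ

/-- `s` is open and `f` restricts to a diffeomorphism of `s` onto an open subset of `M'`. -/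
def IsOpenDiffeoOn (𝕜 E E' : Type*) [RCLike 𝕜] [AddCommGroup E] [Module 𝕜 E]
    [TopologicalSpace E] [AddCommGroup E'] [Module 𝕜 E'] [TopologicalSpace E'] {M M' : Type*}
    [tM : TopologicalSpace M] [cM : ChartedSpace E M]
    [tM' : TopologicalSpace M'] [cM' : ChartedSpace E' M'] (f : M → M') (s : Set M) : Prop :=
  IsOpen s ∧ IsOpen (f '' s) ∧ MSmoothOn 𝕜 E E' f s ∧
    ∃ g : M' → M, LeftInvOn g f s ∧ MSmoothOn 𝕜 E' E g (f '' s)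

/-- Smooth manifolds modelled on the locally convex space `E`: all chart changes of the atlas
are smooth. -/
class SmoothManifold (𝕜 E M : Type*) [RCLike 𝕜] [AddCommGroup E] [Module 𝕜 E]
    [TopologicalSpace E] [LocallyConvexTVS 𝕜 E] [TopologicalSpace M] [ChartedSpace E M] :
    Prop where
  compatible : ∀ e ∈ atlas E M, ∀ e' ∈ atlas E M,
    SmoothOn 𝕜 (e' ∘ e.symm) (e.target ∩ e.symm ⁻¹' e'.source)

/-- Lie groups modelled on the locally convex space `E`. -/
class LieGrp (𝕜 E G : Type*) [RCLike 𝕜] [AddCommGroup E] [Module 𝕜 E]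
    [TopologicalSpace E] [LocallyConvexTVS 𝕜 E] [Group G] [TopologicalSpace G]
    [ChartedSpace E G] : Prop extends SmoothManifold 𝕜 E G where
  smooth_mul : MSmooth 𝕜 (E × E) E (fun p : G × G => p.1 * p.2)
  smooth_inv : MSmooth 𝕜 E E (fun g : G => g⁻¹)

/-- A Lie group structure, modelled on `E`, on the abstract group `X`. -/
structure LieGrpStructure (𝕜 E X : Type*) [RCLike 𝕜] [AddCommGroup E] [Module 𝕜 E]
    [TopologicalSpace E] [LocallyConvexTVS 𝕜 E] [Group X] where
  top : TopologicalSpace X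
  charts : ChartedSpace E X
  lieGrp : LieGrp 𝕜 E X

/-- Two Lie group structures on `X` (possibly with different model spaces and atlases) are the
same if the identity map of `X` is a diffeomorphism between them. -/
def LieGrpStructure.Same {𝕜 E E' X : Type*} [RCLike 𝕜] [AddCommGroup E] [Module 𝕜 E]
    [TopologicalSpace E] [LocallyConvexTVS 𝕜 E] [AddCommGroup E'] [Module 𝕜 E']
    [TopologicalSpace E'] [LocallyConvexTVS 𝕜 E'] [Group X]
    (L : LieGrpStructure 𝕜 E X) (L' : LieGrpStructure 𝕜 E' X) : Prop :=
  MSmooth 𝕜 E E' (tM := L.top) (cM := L.charts) (tM' := L'.top) (cM' := L'.charts) (id : X → X) ∧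
  MSmooth 𝕜 E' E (tM := L'.top) (cM := L'.charts) (tM' := L.top) (cM' := L.charts) (id : X → X)

/-! ### Locally smooth cochains and factor systems -/

section Cochains

variable (𝕜 EG EN : Type*) [RCLike 𝕜]
  [AddCommGroup EG] [Module 𝕜 EG] [TopologicalSpace EG]
  [AddCommGroup EN] [Module 𝕜 EN] [TopologicalSpace EN]
  {G N : Type*} [Group G] [TopologicalSpace G] [ChartedSpace EG G]
  [Group N] [TopologicalSpace N] [ChartedSpace EN N]

/-- `f` is smooth on some open identity neighbourhood. -/
def SmoothNearOne (f : G → N) : Prop :=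
  ∃ U : Set G, IsOpen U ∧ 1 ∈ U ∧ MSmoothOn 𝕜 EG EN f U

/-- `C¹_s(G, N)`: normalized maps `G → N` that are smooth near the identity. -/
def IsC1s (f : G → N) : Prop :=
  f 1 = 1 ∧ SmoothNearOne 𝕜 EG EN f

/-- `C²_s(G, N)`: normalized maps `G × G → N` that are smooth near the identity. -/
def IsC2s (ω : G → G → N) : Prop :=
  (∀ g, ω g 1 = 1) ∧ (∀ g, ω 1 g = 1) ∧
    SmoothNearOne 𝕜 (EG × EG) EN (fun p : G × G => ω p.1 p.2)

/-- `C²_ss(G, N)`: those `ω ∈ C²_s(G, N)` for which each map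
`ω_g : x ↦ ω(g, x) ω(g x g⁻¹, g)⁻¹` is smooth near the identity. -/
def IsC2ss (ω : G → G → N) : Prop :=
  IsC2s 𝕜 EG EN ω ∧ ∀ g, SmoothNearOne 𝕜 EG EN (fun x => ω g x * (ω (g * x * g⁻¹) g)⁻¹)

/-- `C¹_s(G, Aut N)`: maps `S` from `G` to the Lie group automorphisms of `N` with `S 1 = id`
for which `(g, n) ↦ S(g)(n)` is smooth on `U × N` for some open identity neighbourhood `U`. -/
def IsC1sAut (S : G → MulAut N) : Prop :=
  (∀ g, MSmooth 𝕜 EN EN (S g) ∧ MSmooth 𝕜 EN EN (S g).symm) ∧ S 1 = 1 ∧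
    ∃ U : Set G, IsOpen U ∧ 1 ∈ U ∧
      MSmoothOn 𝕜 (EG × EN) EN (fun p : G × N => S p.1 p.2) (U ×ˢ univ)

end Cochains

/-- (Algebraic) factor systems: normalized pairs with `δ_S = C_N ∘ ω` and `d_S ω = 1`. -/
structure IsFactorSystem {G N : Type*} [Group G] [Group N]
    (S : G → MulAut N) (ω : G → G → N) : Prop where
  map_one : S 1 = 1
  right_one : ∀ g, ω g 1 = 1
  left_one : ∀ g, ω 1 g = 1
  delta_eq : ∀ g g', S g * S g' * (S (g * g'))⁻¹ = MulAut.conj (ω g g')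
  cocycle : ∀ g g' g'',
    S g (ω g' g'') * ω g (g' * g'') * (ω (g * g') g'')⁻¹ * (ω g g')⁻¹ = 1

/-- Smooth factor systems `(S, ω) ∈ Z²_ss(G, N)` for the pair `(G, N)`. -/
structure IsSmoothFactorSystem (𝕜 EG EN : Type*) [RCLike 𝕜]
    [AddCommGroup EG] [Module 𝕜 EG] [TopologicalSpace EG]
    [AddCommGroup EN] [Module 𝕜 EN] [TopologicalSpace EN]
    {G N : Type*} [Group G] [TopologicalSpace G] [ChartedSpace EG G]
    [Group N] [TopologicalSpace N] [ChartedSpace EN N]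
    (S : G → MulAut N) (ω : G → G → N) : Prop extends IsFactorSystem S ω where
  isC1sAut : IsC1sAut 𝕜 EG EN S
  isC2ss : IsC2ss 𝕜 EG EN ω

/-- The set `N × G`, to be endowed with the multiplication
`(n, g) (n', g') = (n S(g)(n') ω(g, g'), g g')`. -/
@[ext]
structure TwistedProduct {G N : Type*} [Group G] [Group N] {S : G → MulAut N} {ω : G → G → N}
    (h : IsFactorSystem S ω) where
  fst : N
  snd : G

namespace TwistedProduct

variable {G N : Type*} [Group G] [Group N] {S : G → MulAut N} {ω : G → G → N}
  {h : IsFactorSystem S ω}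

instance : Mul (TwistedProduct h) :=
  ⟨fun a b => ⟨a.fst * S a.snd b.fst * ω a.snd b.snd, a.snd * b.snd⟩⟩

instance : One (TwistedProduct h) := ⟨⟨1, 1⟩⟩

instance : Inv (TwistedProduct h) :=
  ⟨fun a => ⟨(ω a.snd⁻¹ a.snd)⁻¹ * S a.snd⁻¹ a.fst⁻¹, a.snd⁻¹⟩⟩

theorem mul_def (a b : TwistedProduct h) :
    a * b = ⟨a.fst * S a.snd b.fst * ω a.snd b.snd, a.snd * b.snd⟩ := rfl

theorem one_def : (1 : TwistedProduct h) = ⟨1, 1⟩ := rfl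

theorem inv_def (a : TwistedProduct h) :
    a⁻¹ = ⟨(ω a.snd⁻¹ a.snd)⁻¹ * S a.snd⁻¹ a.fst⁻¹, a.snd⁻¹⟩ := rfl

theorem aut_aut (h : IsFactorSystem S ω) (g g' : G) (n : N) :
    S g (S g' n) = ω g g' * S (g * g') n * (ω g g')⁻¹ := by
  have := h.delta_eq g g'
  rw [mul_inv_eq_iff_eq_mul] at this
  have := congrArg (fun φ : MulAut N => φ n) this
  simpa [MulAut.mul_apply, MulAut.conj_apply] using this

instance : Group (TwistedProduct h) :=
  Group.ofLeftAxioms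
    (by
      intro a b c
      have h1 := h.cocycle a.snd b.snd c.snd
      rw [mul_inv_eq_one, mul_inv_eq_iff_eq_mul] at h1
      have h2 := aut_aut h a.snd b.snd c.fst
      ext
      · simp only [mul_def, map_mul, h2]
        simp only [mul_assoc] at h1 ⊢
        simp [h1]
      · simp [mul_def, mul_assoc])
    (by
      intro a
      ext <;> simp [mul_def, one_def, h.map_one, h.left_one])
    (by
      intro a
      ext <;> simp [mul_def, one_def, inv_def, mul_assoc])

/-- The identity map `N × G → N ×_(S,ω) G`, `(n, g) ↦ (n, g)`. -/
def ofProd (h : IsFactorSystem S ω) (p : N × G) : TwistedProduct h := ⟨p.1, p.2⟩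

/-- The short exact sequence `1 → N → N ×_(S,ω) G → G → 1` with `n ↦ (n, 1)` and `(n, g) ↦ g`. -/
def extension (h : IsFactorSystem S ω) : GroupExtension N (TwistedProduct h) G where
  inl :=
    { toFun := fun n => ⟨n, 1⟩
      map_one' := rfl
      map_mul' := fun a b => by ext <;> simp [mul_def, h.map_one, h.left_one] }
  rightHom :=
    { toFun := fun a => a.snd
      map_one' := rfl
      map_mul' := fun _ _ => rfl }
  inl_injective := fun a b hab => congrArg TwistedProduct.fst hab
  range_inl_eq_ker_rightHom := by
    ext a
    constructor
    · rintro ⟨n, rfl⟩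
      rfl
    · intro ha
      exact ⟨a.fst, TwistedProduct.ext rfl (Eq.symm ha)⟩
  rightHom_surjective := fun g => ⟨⟨1, g⟩, rfl⟩

end TwistedProduct

/-! ### Extensions of Lie groups -/

section Extensions

variable (𝕜 EN EH EG : Type*) [RCLike 𝕜]
  [AddCommGroup EN] [Module 𝕜 EN] [TopologicalSpace EN]
  [AddCommGroup EH] [Module 𝕜 EH] [TopologicalSpace EH]
  [AddCommGroup EG] [Module 𝕜 EG] [TopologicalSpace EG]
  {N H G : Type*} [Group N] [TopologicalSpace N] [ChartedSpace EN N]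
  [Group H] [tH : TopologicalSpace H] [cH : ChartedSpace EH H]
  [Group G] [TopologicalSpace G] [ChartedSpace EG G]

/-- The short exact sequence `1 → N → H → G → 1` is an extension of Lie groups: `ι : N → H` and
`q : H → G` are smooth and `q` is a locally trivial smooth `N`-principal bundle (for the right
action of `N` on `H`), i.e. near every point of `G` there are an open set `U` and a section `s`
of `q` over `U` for which the `N`-equivariant map `U × N → q⁻¹(U)`, `(x, n) ↦ s(x) ι(n)`,
is a diffeomorphism. -/
structure IsLieExtension (ext : GroupExtension N H G) : Prop where
  smooth_inl : MSmooth 𝕜 EN EH ext.inl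
  smooth_rightHom : MSmooth 𝕜 EH EG ext.rightHom
  locally_trivial : ∀ g : G, ∃ U : Set G, IsOpen U ∧ g ∈ U ∧ ∃ s : G → H,
    (∀ x ∈ U, ext.rightHom (s x) = x) ∧
    IsOpenDiffeoOn 𝕜 (EG × EN) EH (fun p : G × N => s p.1 * ext.inl p.2) (U ×ˢ univ)

end Extensions

/-- Equivalence of Lie group extensions `N → H → G` and `N → H' → G`: there is an isomorphism of
Lie groups `H → H'` which commutes with the maps from `N` and the maps to `G`. -/
def LieEquivalent (𝕜 EH EH' : Type*) [RCLike 𝕜]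
    [AddCommGroup EH] [Module 𝕜 EH] [TopologicalSpace EH]
    [AddCommGroup EH'] [Module 𝕜 EH'] [TopologicalSpace EH']
    {N H H' G : Type*} [Group N] [Group G]
    [Group H] [tH : TopologicalSpace H] [cH : ChartedSpace EH H]
    [Group H'] [tH' : TopologicalSpace H'] [cH' : ChartedSpace EH' H']
    (ext : GroupExtension N H G) (ext' : GroupExtension N H' G) : Prop :=
  ∃ φ : ext.Equiv ext', MSmooth 𝕜 EH EH' φ ∧ MSmooth 𝕜 EH' EH φ.symm

section SectionCocycle

variable {N H G : Type*} [Group N] [Group H] [Group G] {ext : GroupExtension N H G}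

/-- `C_N ∘ σ : G → Aut(N)`, where `C_N` is the conjugation action of `H` on `N`. -/
noncomputable def sectionAct (σ : ext.Section) (g : G) : MulAut N := ext.conjAct (σ g)

theorem exists_inl_eq (σ : ext.Section) (g g' : G) :
    ∃ n : N, ext.inl n = σ g * σ g' * (σ (g * g'))⁻¹ := by
  rw [← MonoidHom.mem_range, ext.range_inl_eq_ker_rightHom, MonoidHom.mem_ker]
  simp

/-- `δ_σ(g, g') = σ(g) σ(g') σ(g g')⁻¹`, as an element of `N`. -/
noncomputable def sectionCocycle (σ : ext.Section) (g g' : G) : N :=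
  Classical.choose (exists_inl_eq σ g g')

theorem inl_sectionCocycle (σ : ext.Section) (g g' : G) :
    ext.inl (sectionCocycle σ g g') = σ g * σ g' * (σ (g * g'))⁻¹ :=
  Classical.choose_spec (exists_inl_eq σ g g')

end SectionCocycle

/-! ### Lie group structures on `N ×_(S,ω) G` -/

section Structures

variable {𝕜 E G N : Type*} [RCLike 𝕜]
  [AddCommGroup E] [Module 𝕜 E] [TopologicalSpace E] [LocallyConvexTVS 𝕜 E]
  [Group G] [TopologicalSpace G] [Group N] [TopologicalSpace N]
  {S : G → MulAut N} {ω : G → G → N} {h : IsFactorSystem S ω}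

/-- For some open identity neighbourhood `U` of `G`, the identity map
`N × G → N ×_(S,ω) G` restricts to a diffeomorphism of `N × U` onto an open subset. -/
def IsDiffeoOnStrip (EN EG : Type*)
    [AddCommGroup EG] [Module 𝕜 EG] [TopologicalSpace EG] [ChartedSpace EG G]
    [AddCommGroup EN] [Module 𝕜 EN] [TopologicalSpace EN] [ChartedSpace EN N]
    (L : LieGrpStructure 𝕜 E (TwistedProduct h)) : Prop :=
  ∃ U : Set G, IsOpen U ∧ 1 ∈ U ∧
    IsOpenDiffeoOn 𝕜 (EN × EG) E (tM' := L.top) (cM' := L.charts)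
      (TwistedProduct.ofProd h) (univ ×ˢ U)

/-- For some open identity neighbourhood `U` of `G`, the identity map
`N × G → N ×_(S,ω) G` is smooth on `N × U`. -/
def IsSmoothOnStrip (EN EG : Type*)
    [AddCommGroup EG] [Module 𝕜 EG] [TopologicalSpace EG] [ChartedSpace EG G]
    [AddCommGroup EN] [Module 𝕜 EN] [TopologicalSpace EN] [ChartedSpace EN N]
    (L : LieGrpStructure 𝕜 E (TwistedProduct h)) : Prop :=
  ∃ U : Set G, IsOpen U ∧ 1 ∈ U ∧
    MSmoothOn 𝕜 (EN × EG) E (tM' := L.top) (cM' := L.charts)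
      (TwistedProduct.ofProd h) (univ ×ˢ U)

/-- With the Lie group structure `L`, the sequence `N → N ×_(S,ω) G → G` is an extension of
Lie groups. -/
def IsExtensionWith (EN EG : Type*)
    [AddCommGroup EG] [Module 𝕜 EG] [TopologicalSpace EG] [ChartedSpace EG G]
    [AddCommGroup EN] [Module 𝕜 EN] [TopologicalSpace EN] [ChartedSpace EN N]
    (L : LieGrpStructure 𝕜 E (TwistedProduct h)) : Prop :=
  IsLieExtension 𝕜 EN E EG (tH := L.top) (cH := L.charts) (TwistedProduct.extension h)

end Structures

end LCLie

open LCLie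

/-!
Smoothness questions about Lie groups are questions about germs at `1`. A homomorphism of Lie groups
that is smooth at `1` is smooth, because left translations are diffeomorphisms. Conversely, let `φ`
be a bijection from a group onto a manifold. If the multiplication, the inversion and every
conjugation, read through `φ`, are smooth near `φ 1`, then the left translates of `φ`, restricted to
a small neighbourhood of `1`, are charts of a Lie group structure.

For a smooth factor system take `φ` to be the identity map `N ×_(S,ω) G → N × G`. Conjugation by
`(m, c)` is conjugation by `(1, c)` followed by conjugation by `ι m`. The first is smooth at `1` by
the smoothness of `S c` and the condition on `x ↦ ω(c, x) ω(c x c⁻¹, c)⁻¹`, the second because `S`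
is smooth near `1`. Uniqueness and the equivalence of extensions are comparisons of homomorphisms at
`1`. From the germ one passes to the strip `N × U` by `(n, g) = ι n * (1, g)`. Conversely, a map
into `N` is smooth if its composite with `ι` is, since local triviality gives a retraction of `ι`
that is smooth near `1`; this controls the `N`-component of the inverse on the strip.
-/

namespace LCLie

section Calculus

variable {𝕜 : Type*} [RCLike 𝕜] {n : ℕ}
  {E : Type*} [AddCommGroup E] [Module 𝕜 E]
  {F : Type*} [AddCommGroup F] [Module 𝕜 F] [TopologicalSpace F]

theorem HasDirDeriv.comp_line [Module ℝ F] [IsScalarTower ℝ 𝕜 F] {f : E → F} {x k : E} {t : 𝕜}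
    (ht : t ≠ 0) {s : ℝ} {y : F} (hf : HasDirDeriv 𝕜 f (x + ((s : 𝕜) * t) • k) k y) :
    HasDirDeriv ℝ (fun r : ℝ => t⁻¹ • f (x + ((r : 𝕜) * t) • k)) s 1 y := by
  have hscale : Tendsto (fun r : ℝ => (r : 𝕜) * t) (𝓝[≠] 0) (𝓝[≠] 0) := by
    refine tendsto_nhdsWithin_iff.2 ⟨?_, ?_⟩
    · exact (Continuous.tendsto' (by fun_prop) _ _ (by simp)).mono_left nhdsWithin_le_nhds
    · filter_upwards [self_mem_nhdsWithin] with r (hr : r ≠ 0)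
      simp [hr, ht]
  refine (Tendsto.comp hf hscale).congr fun r => ?_
  have hpoint : x + (((s + r • 1 : ℝ) : 𝕜) * t) • k =
      x + ((s : 𝕜) * t) • k + ((r : 𝕜) * t) • k := by
    rw [smul_eq_mul, mul_one, RCLike.ofReal_add, add_mul, add_smul, add_assoc]
  simp only [Function.comp_apply, hpoint]
  rw [← smul_sub, mul_inv, mul_smul, ← RCLike.ofReal_inv, ← RCLike.real_smul_eq_coe_smul]

variable [TopologicalSpace E]

theorem HasDirDeriv.congr_of_eventuallyEq [ContinuousAdd E] [ContinuousSMul 𝕜 E] {f g : E → F}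
    {x h : E} {y : F} (hf : HasDirDeriv 𝕜 f x h y) (hfg : f =ᶠ[𝓝 x] g) :
    HasDirDeriv 𝕜 g x h y := by
  have hline : Tendsto (fun t : 𝕜 => x + t • h) (𝓝 0) (𝓝 x) :=
    Continuous.tendsto' (by fun_prop) _ _ (by simp)
  refine Tendsto.congr' ?_ hf
  filter_upwards [(hline.eventually hfg).filter_mono nhdsWithin_le_nhds] with t ht
  rw [ht, hfg.eq_of_nhds]

theorem CnOn.continuousOn {f : E → F} {U : Set E} (hf : CnOn 𝕜 n f U) : ContinuousOn f U := by
  cases n with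
  | zero => exact hf
  | succ n => exact hf.1

theorem CnOn.mono {f : E → F} {U V : Set E} (hf : CnOn 𝕜 n f U) (hV : V ⊆ U) :
    CnOn 𝕜 n f V := by
  induction n generalizing E with
  | zero => exact ContinuousOn.mono hf hV
  | succ n ih =>
    obtain ⟨hc, df, hd, hdf⟩ := hf
    exact ⟨hc.mono hV, df, fun x hx => hd x (hV hx), ih hdf (prod_mono hV subset_rfl)⟩

theorem CnOn.of_succ {f : E → F} {U : Set E} (hf : CnOn 𝕜 (n + 1) f U) : CnOn 𝕜 n f U := by
  induction n generalizing E with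
  | zero => exact hf.1
  | succ n ih =>
    obtain ⟨hc, df, hd, hdf⟩ := hf
    exact ⟨hc, df, hd, ih hdf⟩

theorem CnOn.congr [ContinuousAdd E] [ContinuousSMul 𝕜 E] {f g : E → F} {U : Set E}
    (hf : CnOn 𝕜 n f U) (hU : IsOpen U) (hfg : EqOn f g U) : CnOn 𝕜 n g U := by
  cases n with
  | zero => exact ContinuousOn.congr hf hfg.symm
  | succ n =>
    obtain ⟨hc, df, hd, hdf⟩ := hf
    exact ⟨hc.congr hfg.symm, df, fun x hx h => (hd x hx h).congr_of_eventuallyEq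
      (hfg.eventuallyEq_of_mem (hU.mem_nhds hx)), hdf⟩

theorem cnOn_const (c : F) (U : Set E) : CnOn 𝕜 n (fun _ => c) U := by
  induction n generalizing E c with
  | zero => exact continuousOn_const
  | succ n ih =>
    refine ⟨continuousOn_const, fun _ => 0, fun x _ h => ?_, ih 0 _⟩
    simpa [HasDirDeriv] using tendsto_const_nhds

theorem CnOn.prodMk {F' : Type*} [AddCommGroup F'] [Module 𝕜 F'] [TopologicalSpace F']
    {f : E → F} {g : E → F'} {U : Set E} (hf : CnOn 𝕜 n f U) (hg : CnOn 𝕜 n g U) :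
    CnOn 𝕜 n (fun x => (f x, g x)) U := by
  induction n generalizing E with
  | zero => exact ContinuousOn.prodMk hf hg
  | succ n ih =>
    obtain ⟨hfc, df, hdf, hdf'⟩ := hf
    obtain ⟨hgc, dg, hdg, hdg'⟩ := hg
    exact ⟨hfc.prodMk hgc, fun p => (df p, dg p),
      fun x hx h => (hdf x hx h).prodMk_nhds (hdg x hx h), ih hdf' hdg'⟩

theorem CnOn.comp_continuousLinearMap {E' : Type*} [AddCommGroup E'] [Module 𝕜 E']
    [TopologicalSpace E'] {f : E → F} {U : Set E} (hf : CnOn 𝕜 n f U) (A : E' →L[𝕜] E) :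
    CnOn 𝕜 n (f ∘ A) (A ⁻¹' U) := by
  induction n generalizing E E' with
  | zero => exact ContinuousOn.comp hf A.continuous.continuousOn (mapsTo_preimage _ _)
  | succ n ih =>
    obtain ⟨hc, df, hd, hdf⟩ := hf
    refine ⟨hc.comp A.continuous.continuousOn (mapsTo_preimage _ _), df ∘ A.prodMap A,
      fun x hx h => ?_, (ih hdf (A.prodMap A)).mono fun p hp => ⟨hp.1, mem_univ _⟩⟩
    simpa [HasDirDeriv, Function.comp_def] using hd (A x) hx (A h)

theorem CnOn.of_local [ContinuousAdd E] [ContinuousSMul 𝕜 E] [T2Space F] {f : E → F} {U : Set E}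
    (hf : ∀ x ∈ U, ∃ V, IsOpen V ∧ x ∈ V ∧ CnOn 𝕜 n f V) : CnOn 𝕜 n f U := by
  have hc : ContinuousOn f U := fun x hx =>
    let ⟨_, hV, hxV, hfV⟩ := hf x hx
    (hfV.continuousOn.continuousAt (hV.mem_nhds hxV)).continuousWithinAt
  induction n generalizing E with
  | zero => exact hc
  | succ n ih =>
    let df (p : E × E) : F :=
      limUnder (𝓝[≠] (0 : 𝕜)) fun t : 𝕜 => t⁻¹ • (f (p.1 + t • p.2) - f p.1)
    have hdf : ∀ p ∈ U ×ˢ (univ : Set E), ∃ V, IsOpen V ∧ p ∈ V ∧ CnOn 𝕜 n df V := by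
      rintro ⟨x, h⟩ ⟨hx, -⟩
      obtain ⟨V, hV, hxV, -, dg, hd, hdg⟩ := hf x hx
      exact ⟨V ×ˢ univ, hV.prod isOpen_univ, ⟨hxV, mem_univ _⟩, hdg.congr
        (hV.prod isOpen_univ) fun p hp => (Tendsto.limUnder_eq (hd p.1 hp.1 p.2)).symm⟩
    refine ⟨hc, df, fun x hx h => ?_, ih hdf fun p hp => ?_⟩
    · obtain ⟨V, -, hxV, -, dg, hd, -⟩ := hf x hx
      exact tendsto_nhds_limUnder ⟨_, hd x hxV h⟩
    · obtain ⟨V, hV, hpV, hdfV⟩ := hdf p hp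
      exact (hdfV.continuousOn.continuousAt (hV.mem_nhds hpV)).continuousWithinAt

end Calculus

section ChainRule

theorem sub_mem_of_hasDirDeriv_mem {F : Type*} [AddCommGroup F] [Module ℝ F] [TopologicalSpace F]
    [IsTopologicalAddGroup F] [ContinuousSMul ℝ F] {C : Set F} (hC : IsOpen C)
    (hCc : Convex ℝ C) {γ γ' : ℝ → F} (hγ : ∀ s ∈ Icc (0 : ℝ) 1, HasDirDeriv ℝ γ s 1 (γ' s))
    (hγ' : ∀ s ∈ Icc (0 : ℝ) 1, γ' s ∈ C) : γ 1 - γ 0 ∈ C := by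
  -- A separating functional reduces the claim to the scalar mean value theorem.
  by_contra hnot
  obtain ⟨l, hl⟩ := geometric_hahn_banach_open_point hCc hC hnot
  have hder : ∀ s ∈ Icc (0 : ℝ) 1, HasDerivAt (l ∘ γ) (l (γ' s)) s := fun s hs => by
    rw [hasDerivAt_iff_tendsto_slope_zero]
    simpa [Function.comp_def] using (l.continuous.tendsto _).comp (hγ s hs)
  obtain ⟨s, hs, hslope⟩ := exists_hasDerivAt_eq_slope _ _ zero_lt_one
    (fun s hs => (hder s hs).continuousAt.continuousWithinAt)
    (fun s hs => hder s (Ioo_subset_Icc_self hs))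
  have hlt := hl _ (hγ' s (Ioo_subset_Icc_self hs))
  simp [hslope] at hlt

variable {𝕜 : Type*} [RCLike 𝕜] {n : ℕ}
  {E : Type*} [AddCommGroup E] [Module 𝕜 E] [TopologicalSpace E]
  {F : Type*} [AddCommGroup F] [Module 𝕜 F] [TopologicalSpace F] [LocallyConvexTVS 𝕜 F]

theorem tendsto_differenceQuotient [ContinuousAdd E] [ContinuousSMul 𝕜 E] {f : E → F}
    {df : E × E → F} {U : Set E} (hU : IsOpen U)
    (hd : ∀ x ∈ U, ∀ h, HasDirDeriv 𝕜 f x h (df (x, h))) (hc : ContinuousOn df (U ×ˢ univ))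
    {x h : E} (hx : x ∈ U) {k : 𝕜 → E} (hk : Tendsto k (𝓝[≠] 0) (𝓝 h)) :
    Tendsto (fun t => t⁻¹ • (f (x + t • k t) - f x)) (𝓝[≠] 0) (𝓝 (df (x, h))) := by
  let : Module ℝ F := Module.compHom F (algebraMap ℝ 𝕜)
  have : LocallyConvexSpace ℝ F := LocallyConvexTVS.locallyConvex (𝕜 := 𝕜)
  have : IsScalarTower ℝ 𝕜 F := ⟨fun r c y => by
    rw [RCLike.real_smul_eq_coe_mul, mul_smul]; rfl⟩
  have : ContinuousSMul ℝ F := IsScalarTower.continuousSMul (M := ℝ) (α := F) 𝕜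
  rw [(LocallyConvexSpace.convex_basis (𝕜 := ℝ) (df (x, h))).tendsto_right_iff]
  rintro C ⟨hxC, hC⟩
  have hnear : ∀ᶠ p : E × E in 𝓝 (x, h), p.1 ∈ U ∧ df p ∈ interior C := by
    have hUx : U ×ˢ (univ : Set E) ∈ 𝓝 (x, h) :=
      (hU.prod isOpen_univ).mem_nhds ⟨hx, mem_univ _⟩
    filter_upwards [hUx, (hc.continuousAt hUx).eventually_mem (interior_mem_nhds.2 hxC)]
      with p hp hpC using ⟨hp.1, hpC⟩
  have hline : Tendsto (fun p : 𝕜 × E => (x + p.1 • p.2, p.2)) (𝓝 0 ×ˢ 𝓝 h) (𝓝 (x, h)) := by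
    rw [← nhds_prod_eq]
    exact Continuous.tendsto' (by fun_prop) _ _ (by simp)
  obtain ⟨P, hP, K, hK, hPK⟩ := Filter.eventually_prod_iff.1 (hline.eventually hnear)
  obtain ⟨ε, hε, hPε⟩ := Metric.eventually_nhds_iff_ball.1 hP
  filter_upwards [hk.eventually hK, self_mem_nhdsWithin,
    mem_nhdsWithin_of_mem_nhds (Metric.ball_mem_nhds (0 : 𝕜) hε)] with t htK (ht0 : t ≠ 0) htε
  have hsegment : ∀ s ∈ Icc (0 : ℝ) 1, x + ((s : 𝕜) * t) • k t ∈ U ∧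
      df (x + ((s : 𝕜) * t) • k t, k t) ∈ interior C := fun s hs => by
    refine hPK (hPε _ ?_) htK
    rw [mem_ball_zero_iff] at htε ⊢
    rw [norm_mul, RCLike.norm_ofReal, abs_of_nonneg hs.1]
    exact (mul_le_of_le_one_left (norm_nonneg _) hs.2).trans_lt htε
  have hquotient := sub_mem_of_hasDirDeriv_mem isOpen_interior hC.interior
    (fun s hs => (hd _ (hsegment s hs).1 (k t)).comp_line ht0) fun s hs => (hsegment s hs).2
  exact interior_subset (by simpa [smul_sub] using hquotient)

theorem CnOn.comp [ContinuousAdd E] [ContinuousSMul 𝕜 E]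
    {K : Type*} [AddCommGroup K] [Module 𝕜 K] [TopologicalSpace K] [LocallyConvexTVS 𝕜 K]
    {g : F → K} {f : E → F} {V : Set F} {U : Set E} (hg : CnOn 𝕜 n g V) (hf : CnOn 𝕜 n f U)
    (hV : IsOpen V) (hfU : MapsTo f U V) : CnOn 𝕜 n (g ∘ f) U := by
  induction n generalizing E F with
  | zero => exact ContinuousOn.comp hg hf hfU
  | succ n ih =>
    have hfn := hf.of_succ
    obtain ⟨hgc, dg, hdg, hdgn⟩ := hg
    obtain ⟨hfc, df, hdf, hdfn⟩ := hf
    refine ⟨hgc.comp hfc hfU, dg ∘ fun p => (f p.1, df p), fun x hx h => ?_, ?_⟩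
    · refine (tendsto_differenceQuotient hV hdg hdgn.continuousOn (hfU hx) (hdf x hx h)).congr' ?_
      filter_upwards [self_mem_nhdsWithin] with t (ht : t ≠ 0)
      simp [smul_smul, ht]
    · have hfst : CnOn 𝕜 n (fun p : E × E => f p.1) (U ×ˢ univ) :=
        (hfn.comp_continuousLinearMap (ContinuousLinearMap.fst 𝕜 E E)).mono fun p hp => hp.1
      exact ih hdgn (hfst.prodMk hdfn) (hV.prod isOpen_univ)
        fun p hp => ⟨hfU hp.1, mem_univ _⟩

end ChainRule

section SmoothOn

variable {𝕜 : Type*} [RCLike 𝕜] {E F K : Type*}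
  [AddCommGroup E] [Module 𝕜 E] [TopologicalSpace E]
  [AddCommGroup F] [Module 𝕜 F] [TopologicalSpace F]
  [AddCommGroup K] [Module 𝕜 K] [TopologicalSpace K] {f : E → F} {U : Set E}

theorem SmoothOn.mono {V : Set E} (hf : SmoothOn 𝕜 f U) (hV : V ⊆ U) : SmoothOn 𝕜 f V :=
  fun n => (hf n).mono hV

theorem SmoothOn.prodMk {g : E → K} (hf : SmoothOn 𝕜 f U) (hg : SmoothOn 𝕜 g U) :
    SmoothOn 𝕜 (fun x => (f x, g x)) U :=
  fun n => (hf n).prodMk (hg n)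

theorem SmoothOn.comp_continuousLinearMap (hf : SmoothOn 𝕜 f U) (A : K →L[𝕜] E) :
    SmoothOn 𝕜 (f ∘ A) (A ⁻¹' U) :=
  fun n => (hf n).comp_continuousLinearMap A

variable [ContinuousAdd E] [ContinuousSMul 𝕜 E]

theorem SmoothOn.congr {g : E → F} (hf : SmoothOn 𝕜 f U) (hU : IsOpen U) (hfg : EqOn f g U) :
    SmoothOn 𝕜 g U :=
  fun n => (hf n).congr hU hfg

theorem SmoothOn.of_local [T2Space F]
    (hf : ∀ x ∈ U, ∃ V, IsOpen V ∧ x ∈ V ∧ SmoothOn 𝕜 f V) : SmoothOn 𝕜 f U :=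
  fun n => CnOn.of_local fun x hx => let ⟨V, hV, hxV, hfV⟩ := hf x hx; ⟨V, hV, hxV, hfV n⟩

theorem SmoothOn.comp [LocallyConvexTVS 𝕜 F] [LocallyConvexTVS 𝕜 K] {g : F → K} {V : Set F}
    (hg : SmoothOn 𝕜 g V) (hf : SmoothOn 𝕜 f U) (hV : IsOpen V) (hfU : MapsTo f U V) :
    SmoothOn 𝕜 (g ∘ f) U :=
  fun n => (hg n).comp (hf n) hV hfU

end SmoothOn

section Manifolds

theorem isOpen_chart_domain {H H' M M' : Type*} [TopologicalSpace H] [TopologicalSpace H']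
    [TopologicalSpace M] [TopologicalSpace M'] {f : M → M'} {s : Set M} (hs : IsOpen s)
    (hf : ContinuousOn f s) (e : OpenPartialHomeomorph M H) (e' : OpenPartialHomeomorph M' H') :
    IsOpen (e.target ∩ e.symm ⁻¹' (s ∩ f ⁻¹' e'.source)) :=
  e.isOpen_inter_preimage_symm (hf.isOpen_inter_preimage hs e'.open_source)

variable {𝕜 : Type*} [RCLike 𝕜]
  {E : Type*} [AddCommGroup E] [Module 𝕜 E] [TopologicalSpace E]
  {E' : Type*} [AddCommGroup E'] [Module 𝕜 E'] [TopologicalSpace E']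
  {E'' : Type*} [AddCommGroup E''] [Module 𝕜 E''] [TopologicalSpace E'']
  {M : Type*} [TopologicalSpace M] [ChartedSpace E M]
  {M' : Type*} [TopologicalSpace M'] [ChartedSpace E' M']
  {M'' : Type*} [TopologicalSpace M''] [ChartedSpace E'' M'']
  {f : M → M'} {s : Set M}

theorem MSmoothOn.mono {t : Set M} (hf : MSmoothOn 𝕜 E E' f s) (ht : t ⊆ s) :
    MSmoothOn 𝕜 E E' f t :=
  ⟨hf.1.mono ht, fun e he e' he' => (hf.2 e he e' he').mono fun _ hx => ⟨hx.1, ht hx.2.1, hx.2.2⟩⟩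

theorem MSmoothOn.prodMk {g : M → M''} (hf : MSmoothOn 𝕜 E E' f s) (hg : MSmoothOn 𝕜 E E'' g s) :
    MSmoothOn 𝕜 E (E' × E'') (fun x => (f x, g x)) s := by
  refine ⟨hf.1.prodMk hg.1, ?_⟩
  rintro e he _ ⟨e', he', e'', he'', rfl⟩
  exact ((hf.2 e he e' he').mono fun y hy => ⟨hy.1, hy.2.1, hy.2.2.1⟩).prodMk
    ((hg.2 e he e'' he'').mono fun y hy => ⟨hy.1, hy.2.1, hy.2.2.2⟩)

theorem mSmoothOn_const (c : M') (s : Set M) : MSmoothOn 𝕜 E E' (fun _ : M => c) s :=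
  ⟨continuousOn_const, fun _ _ e' _ _ => cnOn_const (e' c) _⟩

theorem MSmoothOn.congr [ContinuousAdd E] [ContinuousSMul 𝕜 E] {g : M → M'}
    (hf : MSmoothOn 𝕜 E E' f s) (hs : IsOpen s) (hfg : EqOn f g s) : MSmoothOn 𝕜 E E' g s := by
  refine ⟨hf.1.congr hfg.symm, fun e he e' he' => ?_⟩
  rw [← hfg.inter_preimage_eq]
  exact (hf.2 e he e' he').congr (isOpen_chart_domain hs hf.1 e e') fun y hy =>
    congrArg e' (hfg hy.2.1)

theorem MSmoothOn.of_local [ContinuousAdd E] [ContinuousSMul 𝕜 E] [T2Space E']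
    (hf : ∀ x ∈ s, ∃ V, IsOpen V ∧ x ∈ V ∧ MSmoothOn 𝕜 E E' f V) : MSmoothOn 𝕜 E E' f s := by
  refine ⟨fun x hx => ?_, fun e he e' he' => SmoothOn.of_local fun y hy => ?_⟩
  · obtain ⟨V, hV, hxV, hfV⟩ := hf x hx
    exact (hfV.1.continuousAt (hV.mem_nhds hxV)).continuousWithinAt
  · obtain ⟨V, hV, hxV, hfV⟩ := hf _ hy.2.1
    exact ⟨_, isOpen_chart_domain hV hfV.1 e e', ⟨hy.1, hxV, hy.2.2⟩, hfV.2 e he e' he'⟩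

theorem MSmoothOn.comp [ContinuousAdd E] [ContinuousSMul 𝕜 E] [LocallyConvexTVS 𝕜 E']
    [LocallyConvexTVS 𝕜 E''] {g : M' → M''} {t : Set M'} (hg : MSmoothOn 𝕜 E' E'' g t)
    (hf : MSmoothOn 𝕜 E E' f s) (ht : IsOpen t) (hs : IsOpen s) (hst : MapsTo f s t) :
    MSmoothOn 𝕜 E E'' (g ∘ f) s := by
  have hc : ContinuousOn (g ∘ f) s := hg.1.comp hf.1 hst
  refine ⟨hc, fun e he e'' he'' => SmoothOn.of_local fun y hy => ?_⟩
  let e' := chartAt E' (f (e.symm y))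
  have he' : e' ∈ atlas E' M' := chart_mem_atlas _ _
  have hopen := (isOpen_chart_domain hs hf.1 e e').inter (isOpen_chart_domain hs hc e e'')
  refine ⟨_, hopen, ⟨⟨hy.1, hy.2.1, mem_chart_source _ _⟩, hy⟩, ?_⟩
  refine ((hg.2 e' he' e'' he'').comp ((hf.2 e he e' he').mono inter_subset_left)
    (isOpen_chart_domain ht hg.1 e' e'') ?_).congr hopen ?_
  · rintro z ⟨⟨-, hz, hz'⟩, -, -, hz''⟩
    refine ⟨e'.map_source hz', ?_⟩
    simpa only [Function.comp_apply, mem_preimage, e'.left_inv hz'] using ⟨hst hz, hz''⟩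
  · rintro z ⟨⟨-, -, hz'⟩, -⟩
    simp only [Function.comp_apply, e'.left_inv hz']

section LocallyConvex

variable [LocallyConvexTVS 𝕜 E] [LocallyConvexTVS 𝕜 E']

theorem mSmoothOn_id [SmoothManifold 𝕜 E M] (s : Set M) : MSmoothOn 𝕜 E E (id : M → M) s :=
  ⟨continuousOn_id, fun e he e' he' =>
    (SmoothManifold.compatible e he e' he').mono fun _ hy => ⟨hy.1, hy.2.2⟩⟩

instance [SmoothManifold 𝕜 E M] [SmoothManifold 𝕜 E' M'] :
    SmoothManifold 𝕜 (E × E') (M × M') where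
  compatible := by
    rintro _ ⟨e, he, e', he', rfl⟩ _ ⟨e₁, he₁, e₁', he₁', rfl⟩
    exact (((SmoothManifold.compatible (𝕜 := 𝕜) e he e₁ he₁).comp_continuousLinearMap
      (ContinuousLinearMap.fst 𝕜 E E')).mono fun y hy => ⟨hy.1.1, hy.2.1⟩).prodMk
      (((SmoothManifold.compatible (𝕜 := 𝕜) e' he' e₁' he₁').comp_continuousLinearMap
      (ContinuousLinearMap.snd 𝕜 E E')).mono fun y hy => ⟨hy.1.2, hy.2.2⟩)

end LocallyConvex

theorem mSmoothOn_fst [LocallyConvexTVS 𝕜 E] [SmoothManifold 𝕜 E M] (s : Set (M × M')) :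
    MSmoothOn 𝕜 (E × E') E (Prod.fst : M × M' → M) s := by
  refine ⟨continuousOn_fst, ?_⟩
  rintro _ ⟨e, he, e', _, rfl⟩ e₁ he₁
  exact ((SmoothManifold.compatible (𝕜 := 𝕜) e he e₁ he₁).comp_continuousLinearMap
    (ContinuousLinearMap.fst 𝕜 E E')).mono fun y hy => ⟨hy.1.1, hy.2.2⟩

theorem mSmoothOn_snd [LocallyConvexTVS 𝕜 E'] [SmoothManifold 𝕜 E' M'] (s : Set (M × M')) :
    MSmoothOn 𝕜 (E × E') E' (Prod.snd : M × M' → M') s := by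
  refine ⟨continuousOn_snd, ?_⟩
  rintro _ ⟨e, _, e', he', rfl⟩ e₁ he₁
  exact ((SmoothManifold.compatible (𝕜 := 𝕜) e' he' e₁ he₁).comp_continuousLinearMap
    (ContinuousLinearMap.snd 𝕜 E E')).mono fun y hy => ⟨hy.1.2, hy.2.2⟩

/-- The map `f` is smooth at the point `x`: it is smooth on an open neighbourhood of `x`.
For `x = 1` this is `SmoothNearOne`. -/
def MSmoothAt (𝕜 E E' : Type*) [RCLike 𝕜] [AddCommGroup E] [Module 𝕜 E] [TopologicalSpace E]
    [AddCommGroup E'] [Module 𝕜 E'] [TopologicalSpace E'] {M M' : Type*}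
    [tM : TopologicalSpace M] [cM : ChartedSpace E M]
    [tM' : TopologicalSpace M'] [cM' : ChartedSpace E' M'] (f : M → M') (x : M) : Prop :=
  ∃ U : Set M, IsOpen U ∧ x ∈ U ∧ MSmoothOn 𝕜 E E' f U

theorem MSmoothOn.mSmoothAt (hf : MSmoothOn 𝕜 E E' f s) (hs : IsOpen s) {x : M} (hx : x ∈ s) :
    MSmoothAt 𝕜 E E' f x :=
  ⟨s, hs, hx, hf⟩

theorem MSmooth.mSmoothAt (hf : MSmooth 𝕜 E E' f) (x : M) : MSmoothAt 𝕜 E E' f x :=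
  MSmoothOn.mSmoothAt hf isOpen_univ (mem_univ x)

theorem MSmooth.continuous (hf : MSmooth 𝕜 E E' f) : Continuous f :=
  continuousOn_univ.1 hf.1

theorem mSmoothOn_of_forall_mSmoothAt [ContinuousAdd E] [ContinuousSMul 𝕜 E] [T2Space E']
    (hf : ∀ x ∈ s, MSmoothAt 𝕜 E E' f x) : MSmoothOn 𝕜 E E' f s :=
  MSmoothOn.of_local hf

theorem mSmooth_of_forall_mSmoothAt [ContinuousAdd E] [ContinuousSMul 𝕜 E] [T2Space E']
    (hf : ∀ x, MSmoothAt 𝕜 E E' f x) : MSmooth 𝕜 E E' f :=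
  mSmoothOn_of_forall_mSmoothAt fun x _ => hf x

variable {x : M}

theorem MSmoothAt.eventually (hf : MSmoothAt 𝕜 E E' f x) : ∀ᶠ y in 𝓝 x, MSmoothAt 𝕜 E E' f y :=
  let ⟨_, hU, hxU, hfU⟩ := hf
  eventually_of_mem (hU.mem_nhds hxU) fun _ hy => hfU.mSmoothAt hU hy

theorem MSmoothAt.continuousAt (hf : MSmoothAt 𝕜 E E' f x) : ContinuousAt f x :=
  let ⟨_, hU, hxU, hfU⟩ := hf
  hfU.1.continuousAt (hU.mem_nhds hxU)

theorem MSmoothAt.congr_of_eventuallyEq [ContinuousAdd E] [ContinuousSMul 𝕜 E] {g : M → M'}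
    (hf : MSmoothAt 𝕜 E E' f x) (hfg : f =ᶠ[𝓝 x] g) : MSmoothAt 𝕜 E E' g x := by
  obtain ⟨U, hU, hxU, hfU⟩ := hf
  obtain ⟨V, hfgV, hV, hxV⟩ := mem_nhds_iff.1 hfg
  exact ⟨U ∩ V, hU.inter hV, ⟨hxU, hxV⟩, (hfU.mono inter_subset_left).congr (hU.inter hV)
    fun y hy => hfgV hy.2⟩

theorem MSmoothAt.prodMk {g : M → M''} (hf : MSmoothAt 𝕜 E E' f x)
    (hg : MSmoothAt 𝕜 E E'' g x) : MSmoothAt 𝕜 E (E' × E'') (fun y => (f y, g y)) x := by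
  obtain ⟨U, hU, hxU, hfU⟩ := hf
  obtain ⟨V, hV, hxV, hgV⟩ := hg
  exact ⟨U ∩ V, hU.inter hV, ⟨hxU, hxV⟩,
    (hfU.mono inter_subset_left).prodMk (hgV.mono inter_subset_right)⟩

theorem MSmoothAt.comp_of_eq [ContinuousAdd E] [ContinuousSMul 𝕜 E] [LocallyConvexTVS 𝕜 E']
    [LocallyConvexTVS 𝕜 E''] {g : M' → M''} {y : M'} (hg : MSmoothAt 𝕜 E' E'' g y)
    (hf : MSmoothAt 𝕜 E E' f x) (hy : f x = y) : MSmoothAt 𝕜 E E'' (fun z => g (f z)) x := by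
  subst hy
  obtain ⟨V, hV, hxV, hgV⟩ := hg
  obtain ⟨U, hU, hxU, hfU⟩ := hf
  have hopen := hfU.1.isOpen_inter_preimage hU hV
  exact ⟨U ∩ f ⁻¹' V, hopen, ⟨hxU, hxV⟩,
    hgV.comp (hfU.mono inter_subset_left) hV hopen fun y hy => hy.2⟩

theorem MSmooth.comp_mSmoothAt [ContinuousAdd E] [ContinuousSMul 𝕜 E] [LocallyConvexTVS 𝕜 E']
    [LocallyConvexTVS 𝕜 E''] {g : M' → M''} (hg : MSmooth 𝕜 E' E'' g)
    (hf : MSmoothAt 𝕜 E E' f x) : MSmoothAt 𝕜 E E'' (fun z => g (f z)) x :=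
  (hg.mSmoothAt (f x)).comp_of_eq hf rfl

theorem mSmoothAt_const (c : M') (x : M) : MSmoothAt 𝕜 E E' (fun _ : M => c) x :=
  (mSmoothOn_const c univ).mSmoothAt isOpen_univ (mem_univ x)

theorem mSmoothAt_id [LocallyConvexTVS 𝕜 E] [SmoothManifold 𝕜 E M] (x : M) :
    MSmoothAt 𝕜 E E (fun y : M => y) x :=
  (mSmoothOn_id univ).mSmoothAt isOpen_univ (mem_univ x)

theorem mSmoothAt_fst [LocallyConvexTVS 𝕜 E] [SmoothManifold 𝕜 E M] (x : M × M') :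
    MSmoothAt 𝕜 (E × E') E (fun p : M × M' => p.1) x :=
  (mSmoothOn_fst univ).mSmoothAt isOpen_univ (mem_univ x)

theorem mSmoothAt_snd [LocallyConvexTVS 𝕜 E'] [SmoothManifold 𝕜 E' M'] (x : M × M') :
    MSmoothAt 𝕜 (E × E') E' (fun p : M × M' => p.2) x :=
  (mSmoothOn_snd univ).mSmoothAt isOpen_univ (mem_univ x)

end Manifolds

section CompositeCharts

variable {𝕜 E M X : Type*} [RCLike 𝕜] [AddCommGroup E] [Module 𝕜 E] [TopologicalSpace E]
  [TopologicalSpace M] [ChartedSpace E M] [TopologicalSpace X] [ChartedSpace M X]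

/-- The chart changes of the `M`-valued atlas of `X` are smooth maps between open subsets of the
manifold `M`, which is modelled on `E`. Composing with the charts of `M` then makes `X` a smooth
manifold modelled on `E`. -/
def HasSmoothTransitions (𝕜 E M X : Type*) [RCLike 𝕜] [AddCommGroup E] [Module 𝕜 E]
    [TopologicalSpace E] [TopologicalSpace M] [ChartedSpace E M] [TopologicalSpace X]
    [ChartedSpace M X] : Prop :=
  ∀ Φ ∈ atlas M X, ∀ Ψ ∈ atlas M X,
    MSmoothOn 𝕜 E E (Ψ ∘ Φ.symm) (Φ.target ∩ Φ.symm ⁻¹' Ψ.source)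

theorem HasSmoothTransitions.smoothManifold [LocallyConvexTVS 𝕜 E]
    (h : HasSmoothTransitions 𝕜 E M X) :
    letI := ChartedSpace.comp E M X
    SmoothManifold 𝕜 E X := by
  let := ChartedSpace.comp E M X
  refine ⟨?_⟩
  rintro _ ⟨Φ, hΦ, e, he, rfl⟩ _ ⟨Ψ, hΨ, e', he', rfl⟩
  exact ((h Φ hΦ Ψ hΨ).2 e he e' he').mono fun y hy => ⟨hy.1.1, ⟨hy.1.2, hy.2.1⟩, hy.2.2⟩

theorem HasSmoothTransitions.mSmoothOn_chart (h : HasSmoothTransitions 𝕜 E M X)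
    {Φ : OpenPartialHomeomorph X M} (hΦ : Φ ∈ atlas M X) :
    MSmoothOn 𝕜 E E (cM := ChartedSpace.comp E M X) Φ Φ.source := by
  refine ⟨Φ.continuousOn, ?_⟩
  rintro _ ⟨Ψ, hΨ, e, he, rfl⟩ e' he'
  exact ((h Ψ hΨ Φ hΦ).2 e he e' he').mono fun y hy => ⟨hy.1.1, ⟨hy.1.2, hy.2.1⟩, hy.2.2⟩

theorem HasSmoothTransitions.mSmoothOn_chart_symm (h : HasSmoothTransitions 𝕜 E M X)
    {Φ : OpenPartialHomeomorph X M} (hΦ : Φ ∈ atlas M X) :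
    MSmoothOn 𝕜 E E (cM' := ChartedSpace.comp E M X) Φ.symm Φ.target := by
  refine ⟨Φ.symm.continuousOn, ?_⟩
  rintro e he _ ⟨Ψ, hΨ, e', he', rfl⟩
  exact ((h Φ hΦ Ψ hΨ).2 e he e' he').mono fun y hy => ⟨hy.1, ⟨hy.2.1, hy.2.2.1⟩, hy.2.2.2⟩

end CompositeCharts

section LieGroups

variable {𝕜 E E' E₁ : Type*} [RCLike 𝕜]
  [AddCommGroup E] [Module 𝕜 E] [TopologicalSpace E] [LocallyConvexTVS 𝕜 E]
  [AddCommGroup E'] [Module 𝕜 E'] [TopologicalSpace E'] [LocallyConvexTVS 𝕜 E']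
  [AddCommGroup E₁] [Module 𝕜 E₁] [TopologicalSpace E₁]
  {X X' M : Type*} [Group X] [TopologicalSpace X] [ChartedSpace E X]
  [Group X'] [TopologicalSpace X'] [ChartedSpace E' X']
  [TopologicalSpace M] [ChartedSpace E₁ M]

section PointwiseOperations

variable [ContinuousAdd E₁] [ContinuousSMul 𝕜 E₁] [LieGrp 𝕜 E X] {f g : M → X} {x : M}

theorem MSmoothAt.mul (hf : MSmoothAt 𝕜 E₁ E f x) (hg : MSmoothAt 𝕜 E₁ E g x) :
    MSmoothAt 𝕜 E₁ E (fun y => f y * g y) x :=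
  LieGrp.smooth_mul.comp_mSmoothAt (hf.prodMk hg)

theorem MSmoothAt.inv (hf : MSmoothAt 𝕜 E₁ E f x) : MSmoothAt 𝕜 E₁ E (fun y => (f y)⁻¹) x :=
  LieGrp.smooth_inv.comp_mSmoothAt hf

end PointwiseOperations

theorem mSmooth_of_mSmoothAt_one [LieGrp 𝕜 E X] [LieGrp 𝕜 E' X'] (φ : X →* X')
    (hφ : MSmoothAt 𝕜 E E' φ 1) : MSmooth 𝕜 E E' φ := by
  refine mSmooth_of_forall_mSmoothAt fun a => ?_
  have htranslate : MSmoothAt 𝕜 E E (fun x => a⁻¹ * x) a :=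
    (mSmoothAt_const _ _).mul (mSmoothAt_id _)
  have h : MSmoothAt 𝕜 E E' (fun x => φ a * φ (a⁻¹ * x)) a :=
    (mSmoothAt_const _ _).mul (hφ.comp_of_eq htranslate (inv_mul_cancel a))
  simpa only [map_mul, map_inv, mul_inv_cancel_left] using h

theorem MSmoothAt.of_comp_monoidHom [ContinuousAdd E₁] [ContinuousSMul 𝕜 E₁] [LieGrp 𝕜 E X]
    [LieGrp 𝕜 E' X'] {ι : X →* X'} {r : X' → X} (hr : Function.LeftInverse r ι)
    (hr_one : MSmoothAt 𝕜 E' E r 1) {f : M → X} {x : M}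
    (hf : MSmoothAt 𝕜 E₁ E' (fun y => ι (f y)) x) : MSmoothAt 𝕜 E₁ E f x := by
  have hquot : MSmoothAt 𝕜 E₁ E' (fun y => (ι (f x))⁻¹ * ι (f y)) x :=
    (mSmoothAt_const _ _).mul hf
  have h : MSmoothAt 𝕜 E₁ E (fun y => f x * r ((ι (f x))⁻¹ * ι (f y))) x :=
    (mSmoothAt_const _ _).mul (hr_one.comp_of_eq hquot (inv_mul_cancel _))
  simpa only [← map_inv, ← map_mul, hr _, mul_inv_cancel_left] using h

theorem LieGrp.of_mSmoothAt_one [SmoothManifold 𝕜 E X]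
    (hleft : ∀ a : X, MSmooth 𝕜 E E fun x => a * x)
    (hmul : MSmoothAt 𝕜 (E × E) E (fun p : X × X => p.1 * p.2) (1, 1))
    (hinv : MSmoothAt 𝕜 E E (fun x : X => x⁻¹) 1)
    (hconj : ∀ a : X, MSmoothAt 𝕜 E E (fun x : X => a * x * a⁻¹) 1) : LieGrp 𝕜 E X where
  smooth_mul := by
    refine mSmooth_of_forall_mSmoothAt fun ⟨a, b⟩ => ?_
    have hfst : MSmoothAt 𝕜 (E × E) E (fun p : X × X => b⁻¹ * (a⁻¹ * p.1) * b⁻¹⁻¹) (a, b) :=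
      (hconj b⁻¹).comp_of_eq ((hleft a⁻¹).comp_mSmoothAt (mSmoothAt_fst _)) (inv_mul_cancel a)
    have hsnd : MSmoothAt 𝕜 (E × E) E (fun p : X × X => b⁻¹ * p.2) (a, b) :=
      (hleft b⁻¹).comp_mSmoothAt (mSmoothAt_snd _)
    have h := (hleft (a * b)).comp_mSmoothAt (hmul.comp_of_eq (hfst.prodMk hsnd) (by simp))
    simpa [mul_assoc] using h
  smooth_inv := by
    refine mSmooth_of_forall_mSmoothAt fun a => ?_
    have hquot : MSmoothAt 𝕜 E E (fun x => (a⁻¹ * x)⁻¹) a :=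
      hinv.comp_of_eq ((hleft a⁻¹).mSmoothAt a) (inv_mul_cancel a)
    have h := (hleft a⁻¹).comp_mSmoothAt ((hconj a).comp_of_eq hquot (by simp))
    simpa [mul_assoc] using h

end LieGroups

section LeftCharts

variable {X M : Type*} [Group X]

/-- The chart at `a` of the group `X` obtained by left translation from the bijection `φ` of `X`
onto `M`, restricted so that its values lie in `W`. -/
def leftChart (φ : X ≃ M) (W : Set M) (a : X) : PartialEquiv X M :=
  ((Equiv.mulLeft a).symm.trans φ).toPartialEquivOfImageEq ((fun x => φ (a⁻¹ * x)) ⁻¹' W) W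
    (((Equiv.mulLeft a).symm.trans φ).image_preimage W)

theorem leftChart_comp_symm_apply (φ : X ≃ M) (W : Set M) (a b : X) (p : M) :
    leftChart φ W b ((leftChart φ W a).symm p) = φ (b⁻¹ * a * φ.symm p) :=
  congrArg φ (mul_assoc _ _ _).symm

/-- Smooth local left translations: `W` is an open neighbourhood of `φ 1` in the manifold `M`, and
all left translations of `X`, transported to `M` along `φ`, are smooth where they do not leave
`W`. These are the data from which `X` becomes a manifold with the charts `leftChart φ W a`. -/
structure IsLeftSmooth (𝕜 E : Type*) [RCLike 𝕜] [AddCommGroup E] [Module 𝕜 E]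
    [TopologicalSpace E] [TopologicalSpace M] [ChartedSpace E M] (φ : X ≃ M) (W : Set M) :
    Prop where
  isOpen : IsOpen W
  one_mem : φ 1 ∈ W
  mSmoothAt : ∀ c : X, ∀ p ∈ W, φ (c * φ.symm p) ∈ W →
    MSmoothAt 𝕜 E E (fun p => φ (c * φ.symm p)) p

variable {𝕜 E : Type*} [RCLike 𝕜] [AddCommGroup E] [Module 𝕜 E] [TopologicalSpace E]
  [TopologicalSpace M] [ChartedSpace E M] {φ : X ≃ M} {W : Set M}

namespace IsLeftSmooth

theorem mSmoothAt_leftChart_change (h : IsLeftSmooth 𝕜 E φ W) {a b : X} {p : M}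
    (hp : p ∈ ((leftChart φ W a).symm.trans (leftChart φ W b)).source) :
    MSmoothAt 𝕜 E E (fun p => leftChart φ W b ((leftChart φ W a).symm p)) p := by
  have hpW : φ (b⁻¹ * a * φ.symm p) ∈ W := by
    rw [← leftChart_comp_symm_apply]
    exact hp.2
  simpa only [leftChart_comp_symm_apply] using h.mSmoothAt _ p hp.1 hpW

/-- The topology and the `M`-valued charts of `X` with atlas consisting of the left translates
of `φ`. -/
def chartedSpaceCore (h : IsLeftSmooth 𝕜 E φ W) : ChartedSpaceCore M X where
  atlas := range (leftChart φ W)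
  chartAt := leftChart φ W
  mem_chart_source x := by simpa [leftChart] using h.one_mem
  chart_mem_atlas := mem_range_self
  open_source := by
    rintro _ _ ⟨a, rfl⟩ ⟨b, rfl⟩
    refine isOpen_iff_mem_nhds.2 fun p hp => ?_
    exact inter_mem (h.isOpen.mem_nhds hp.1)
      ((h.mSmoothAt_leftChart_change hp).continuousAt.preimage_mem_nhds (h.isOpen.mem_nhds hp.2))
  continuousOn_toFun := by
    rintro _ _ ⟨a, rfl⟩ ⟨b, rfl⟩
    exact fun p hp => (h.mSmoothAt_leftChart_change hp).continuousAt.continuousWithinAt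

theorem hasSmoothTransitions [LocallyConvexTVS 𝕜 E] (h : IsLeftSmooth 𝕜 E φ W) :
    letI := h.chartedSpaceCore.toTopologicalSpace
    letI := h.chartedSpaceCore.toChartedSpace
    HasSmoothTransitions 𝕜 E M X := by
  intro Φ hΦ Ψ hΨ
  obtain ⟨_, ⟨a, rfl⟩, rfl⟩ := mem_iUnion₂.1 hΦ
  obtain ⟨_, ⟨b, rfl⟩, rfl⟩ := mem_iUnion₂.1 hΨ
  exact mSmoothOn_of_forall_mSmoothAt fun p hp => h.mSmoothAt_leftChart_change hp

theorem exists_smoothManifold [LocallyConvexTVS 𝕜 E] (h : IsLeftSmooth 𝕜 E φ W) :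
    ∃ (_ : TopologicalSpace X) (_ : ChartedSpace E X), SmoothManifold 𝕜 E X ∧
      (∀ a : X, MSmooth 𝕜 E E fun x : X => a * x) ∧
      MSmoothAt 𝕜 E E φ 1 ∧ MSmoothAt 𝕜 E E φ.symm (φ 1) := by
  let := h.chartedSpaceCore.toTopologicalSpace
  let := h.chartedSpaceCore.toChartedSpace
  let := ChartedSpace.comp E M X
  have hchart : ∀ a : X, MSmoothAt 𝕜 E E (fun x => φ (a⁻¹ * x)) a := fun a =>
    (h.hasSmoothTransitions.mSmoothOn_chart (chart_mem_atlas M a)).mSmoothAt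
      (chartAt M a).open_source (mem_chart_source M a)
  have hsymm : ∀ a : X, MSmoothAt 𝕜 E E (fun p => a * φ.symm p) (φ 1) := fun a =>
    (h.hasSmoothTransitions.mSmoothOn_chart_symm (chart_mem_atlas M a)).mSmoothAt
      (chartAt M a).open_target h.one_mem
  refine ⟨_, _, h.hasSmoothTransitions.smoothManifold, fun a => ?_, ?_, ?_⟩
  · refine mSmooth_of_forall_mSmoothAt fun x => ?_
    simpa [mul_assoc] using (hsymm (a * x)).comp_of_eq (hchart x) (by rw [inv_mul_cancel])
  · simpa using hchart 1
  · simpa using hsymm 1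

end IsLeftSmooth

variable [LocallyConvexTVS 𝕜 E] [SmoothManifold 𝕜 E M]

theorem exists_isLeftSmooth
    (hmul : MSmoothAt 𝕜 (E × E) E (fun p : M × M => φ (φ.symm p.1 * φ.symm p.2)) (φ 1, φ 1))
    (hinv : MSmoothAt 𝕜 E E (fun p : M => φ (φ.symm p)⁻¹) (φ 1)) :
    ∃ W, IsLeftSmooth 𝕜 E φ W := by
  have hdiv : MSmoothAt 𝕜 (E × E) E (fun p : M × M => φ (φ.symm p.1 * (φ.symm p.2)⁻¹))
      (φ 1, φ 1) := by
    have := hmul.comp_of_eq ((mSmoothAt_fst (φ 1, φ 1)).prodMk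
      (hinv.comp_of_eq (mSmoothAt_snd (φ 1, φ 1)) rfl)) (by simp)
    simpa using this
  have hmul_near := hmul.eventually
  rw [nhds_prod_eq, eventually_prod_self_iff'] at hmul_near
  obtain ⟨A, hA, hAmul⟩ := hmul_near
  have hdiv_near := hdiv.continuousAt.eventually_mem (s := A) (by simpa using hA)
  rw [nhds_prod_eq, eventually_prod_self_iff'] at hdiv_near
  obtain ⟨B, hB, hBA⟩ := hdiv_near
  refine ⟨interior (A ∩ B), isOpen_interior, mem_interior_iff_mem_nhds.2 (inter_mem hA hB),
    fun c p hp hcp => ?_⟩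
  have hc : φ c ∈ A := by
    simpa using hBA _ (interior_subset hcp).2 p (interior_subset hp).2
  have := (hAmul _ hc p (interior_subset hp).1).comp_of_eq
    ((mSmoothAt_const (E := E) (φ c) p).prodMk (mSmoothAt_id p)) rfl
  simpa using this

theorem exists_lieGrpStructure_of_mSmoothAt
    (hmul : MSmoothAt 𝕜 (E × E) E (fun p : M × M => φ (φ.symm p.1 * φ.symm p.2)) (φ 1, φ 1))
    (hinv : MSmoothAt 𝕜 E E (fun p : M => φ (φ.symm p)⁻¹) (φ 1))
    (hconj : ∀ a : X, MSmoothAt 𝕜 E E (fun p : M => φ (a * φ.symm p * a⁻¹)) (φ 1)) :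
    ∃ L : LieGrpStructure 𝕜 E X,
      MSmoothAt 𝕜 E E (tM := L.top) (cM := L.charts) φ 1 ∧
      MSmoothAt 𝕜 E E (tM' := L.top) (cM' := L.charts) φ.symm (φ 1) := by
  obtain ⟨W, hW⟩ := exists_isLeftSmooth hmul hinv
  obtain ⟨tX, cX, hX, hleft, hφ, hφ_symm⟩ := hW.exists_smoothManifold
  refine ⟨⟨tX, cX, LieGrp.of_mSmoothAt_one hleft ?_ ?_ fun a => ?_⟩, hφ, hφ_symm⟩
  · have hφ₂ : MSmoothAt 𝕜 (E × E) (E × E) (fun p : X × X => (φ p.1, φ p.2)) (1, 1) :=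
      (hφ.comp_of_eq (mSmoothAt_fst (1, 1)) rfl).prodMk (hφ.comp_of_eq (mSmoothAt_snd (1, 1)) rfl)
    simpa using hφ_symm.comp_of_eq (hmul.comp_of_eq hφ₂ rfl) (by simp)
  · simpa using hφ_symm.comp_of_eq (hinv.comp_of_eq hφ rfl) (by simp)
  · simpa using hφ_symm.comp_of_eq ((hconj a).comp_of_eq hφ rfl) (by simp)

end LeftCharts

section GroupExtensions

variable {N H G : Type*} [Group N] [Group H] [Group G] (ext : GroupExtension N H G)

theorem exists_inl_eq_of_rightHom_eq_one {x : H} (hx : ext.rightHom x = 1) :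
    ∃ n, ext.inl n = x := by
  rwa [← MonoidHom.mem_range, ext.range_inl_eq_ker_rightHom, MonoidHom.mem_ker]

variable {ext}

theorem image_section_mul_inl (s : ext.Section) (U : Set G) :
    (fun p : G × N => s p.1 * ext.inl p.2) '' (U ×ˢ univ) = ext.rightHom ⁻¹' U := by
  ext y
  constructor
  · rintro ⟨⟨x, n⟩, ⟨hx, -⟩, rfl⟩
    simpa using hx
  · intro hy
    obtain ⟨n, hn⟩ := exists_inl_eq_of_rightHom_eq_one ext
      (x := (s (ext.rightHom y))⁻¹ * y) (by simp)
    exact ⟨(ext.rightHom y, n), ⟨hy, mem_univ _⟩, by simp [hn]⟩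

end GroupExtensions

section LieExtensions

variable {𝕜 EN EH EG E₁ : Type*} [RCLike 𝕜]
  [AddCommGroup EN] [Module 𝕜 EN] [TopologicalSpace EN] [LocallyConvexTVS 𝕜 EN]
  [AddCommGroup EH] [Module 𝕜 EH] [TopologicalSpace EH] [LocallyConvexTVS 𝕜 EH]
  [AddCommGroup EG] [Module 𝕜 EG] [TopologicalSpace EG] [LocallyConvexTVS 𝕜 EG]
  [AddCommGroup E₁] [Module 𝕜 E₁] [TopologicalSpace E₁]
  {N H G M : Type*} [Group N] [TopologicalSpace N] [ChartedSpace EN N]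
  [Group H] [TopologicalSpace H] [ChartedSpace EH H] [LieGrp 𝕜 EH H]
  [Group G] [TopologicalSpace G] [ChartedSpace EG G]
  [TopologicalSpace M] [ChartedSpace E₁ M] {ext : GroupExtension N H G}

theorem IsLieExtension.exists_retraction [SmoothManifold 𝕜 EN N]
    (hext : IsLieExtension 𝕜 EN EH EG ext) :
    ∃ r : H → N, Function.LeftInverse r ext.inl ∧ MSmoothAt 𝕜 EH EN r 1 := by
  obtain ⟨U, -, h1U, s, -, -, hopen, -, r, hr, hr_smooth⟩ := hext.locally_trivial 1
  have hmem : ∀ n : N, ((1, n) : G × N) ∈ U ×ˢ (univ : Set N) := fun n => ⟨h1U, mem_univ n⟩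
  have hs_mem : s 1 ∈ (fun p : G × N => s p.1 * ext.inl p.2) '' (U ×ˢ univ) :=
    ⟨(1, 1), hmem 1, by simp⟩
  refine ⟨fun y => (r (s 1 * y)).2, fun n => congrArg Prod.snd (hr (hmem n)), ?_⟩
  exact (mSmoothAt_snd _).comp_of_eq ((hr_smooth.mSmoothAt hopen hs_mem).comp_of_eq
    ((mSmoothAt_const _ _).mul (mSmoothAt_id _)) (mul_one _)) rfl

theorem IsLieExtension.exists_section [SmoothManifold 𝕜 EG G]
    (hext : IsLieExtension 𝕜 EN EH EG ext) : ∃ σ : ext.Section, IsC1s 𝕜 EG EH σ := by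
  classical
  obtain ⟨U, hU, h1U, s, hs, hopen, -, hs_smooth, -⟩ := hext.locally_trivial 1
  let σ : G → H := fun x =>
    if x ∈ U then s x * (s 1)⁻¹ else Function.surjInv ext.rightHom_surjective x
  have hσ : Function.RightInverse σ ext.rightHom := by
    intro x
    by_cases hx : x ∈ U
    · simp [σ, hx, hs x hx, hs 1 h1U]
    · simp [σ, hx, Function.surjInv_eq]
  have hs_one : MSmoothAt 𝕜 EG EH (fun x => s x * ext.inl 1) 1 :=
    (hs_smooth.mSmoothAt hopen ⟨h1U, mem_univ 1⟩).comp_of_eq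
      ((mSmoothAt_id 1).prodMk (mSmoothAt_const 1 1)) rfl
  refine ⟨⟨σ, hσ⟩, by simp [σ, h1U], ?_⟩
  refine (hs_one.mul (mSmoothAt_const (s 1)⁻¹ 1)).congr_of_eventuallyEq ?_
  filter_upwards [hU.mem_nhds h1U] with y hy
  simp [σ, hy]

variable [LieGrp 𝕜 EN N]

theorem IsLieExtension.mSmoothAt_of_inl [ContinuousAdd E₁]
    [ContinuousSMul 𝕜 E₁] (hext : IsLieExtension 𝕜 EN EH EG ext) {f : M → N} {x : M}
    (hf : MSmoothAt 𝕜 E₁ EH (fun y => ext.inl (f y)) x) : MSmoothAt 𝕜 E₁ EN f x :=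
  let ⟨_, hr, hr_one⟩ := hext.exists_retraction
  .of_comp_monoidHom hr hr_one hf

section OfSection

variable (hinl : MSmooth 𝕜 EN EH ext.inl) (hrightHom : MSmooth 𝕜 EH EG ext.rightHom)
  {r : H → N} (hr : Function.LeftInverse r ext.inl) (hr_one : MSmoothAt 𝕜 EH EN r 1)
include hinl hrightHom hr hr_one

theorem isOpenDiffeoOn_section_mul_inl [SmoothManifold 𝕜 EG G] {s : ext.Section} {U : Set G}
    (hU : IsOpen U) (hs : ∀ x ∈ U, MSmoothAt 𝕜 EG EH s x) :
    IsOpenDiffeoOn 𝕜 (EG × EN) EH (fun p : G × N => s p.1 * ext.inl p.2) (U ×ˢ univ) := by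
  have hr_apply : ∀ y, ext.inl (r ((s (ext.rightHom y))⁻¹ * y)) = (s (ext.rightHom y))⁻¹ * y := by
    intro y
    obtain ⟨n, hn⟩ := exists_inl_eq_of_rightHom_eq_one ext
      (x := (s (ext.rightHom y))⁻¹ * y) (by simp)
    rw [← hn, hr n]
  refine ⟨hU.prod isOpen_univ, ?_, mSmoothOn_of_forall_mSmoothAt fun p hp => ?_,
    fun y => (ext.rightHom y, r ((s (ext.rightHom y))⁻¹ * y)), fun p _ => ?_, ?_⟩
  · rw [image_section_mul_inl]
    exact hU.preimage hrightHom.continuous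
  · exact ((hs _ hp.1).comp_of_eq (mSmoothAt_fst p) rfl).mul
      (hinl.comp_mSmoothAt (mSmoothAt_snd p))
  · simp [hr _]
  · rw [image_section_mul_inl]
    refine mSmoothOn_of_forall_mSmoothAt fun y hy => (hrightHom.mSmoothAt y).prodMk ?_
    refine .of_comp_monoidHom hr hr_one ?_
    simp only [hr_apply]
    exact ((hs _ hy).comp_of_eq (hrightHom.mSmoothAt y) rfl).inv.mul (mSmoothAt_id y)

theorem IsLieExtension.of_section [LieGrp 𝕜 EG G] {σ : ext.Section}
    (hσ : MSmoothAt 𝕜 EG EH σ 1) : IsLieExtension 𝕜 EN EH EG ext := by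
  refine ⟨hinl, hrightHom, fun g => ?_⟩
  obtain ⟨a, rfl⟩ := ext.rightHom_surjective g
  obtain ⟨U, hU, h1U, hσU⟩ := hσ
  let s : ext.Section := ⟨fun x => a * σ ((ext.rightHom a)⁻¹ * x), fun x => by simp⟩
  have htranslate : ∀ x, MSmoothAt 𝕜 EG EG (fun x => (ext.rightHom a)⁻¹ * x) x := fun x =>
    (mSmoothAt_const _ _).mul (mSmoothAt_id _)
  have hopen : IsOpen ((fun x => (ext.rightHom a)⁻¹ * x) ⁻¹' U) :=
    hU.preimage (continuous_iff_continuousAt.2 fun x => (htranslate x).continuousAt)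
  have hs : ∀ x ∈ (fun x => (ext.rightHom a)⁻¹ * x) ⁻¹' U, MSmoothAt 𝕜 EG EH s x := fun x hx =>
    (mSmoothAt_const a x).mul ((hσU.mSmoothAt hU hx).comp_of_eq (htranslate x) rfl)
  exact ⟨_, hopen, by simpa using h1U, s, fun x _ => s.rightHom_section x,
    isOpenDiffeoOn_section_mul_inl hinl hrightHom hr hr_one hopen hs⟩

end OfSection

end LieExtensions

section SectionCocycle

variable {N H G : Type*} [Group N] [Group H] [Group G] {ext : GroupExtension N H G}

theorem inl_sectionAct (σ : ext.Section) (g : G) (n : N) :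
    ext.inl (sectionAct σ g n) = σ g * ext.inl n * (σ g)⁻¹ :=
  ext.inl_conjAct_comm

theorem inl_sectionAct_symm (σ : ext.Section) (g : G) (n : N) :
    ext.inl ((sectionAct σ g).symm n) = (σ g)⁻¹ * ext.inl n * σ g := by
  have h := inl_sectionAct σ g ((sectionAct σ g).symm n)
  rw [MulEquiv.apply_symm_apply] at h
  simp [h, mul_assoc]

theorem isFactorSystem_section (σ : ext.Section) (hσ : σ 1 = 1) :
    IsFactorSystem (sectionAct σ) (sectionCocycle σ) where
  map_one := by simp [sectionAct, hσ]
  right_one g := ext.inl_injective (by simp [inl_sectionCocycle, hσ])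
  left_one g := ext.inl_injective (by simp [inl_sectionCocycle, hσ])
  delta_eq g g' := by
    rw [mul_inv_eq_iff_eq_mul]
    ext n
    apply ext.inl_injective
    simp [inl_sectionAct, inl_sectionCocycle, mul_assoc]
  cocycle g g' g'' := by
    apply ext.inl_injective
    simp [inl_sectionAct, inl_sectionCocycle, mul_assoc]

variable (σ : ext.Section) (h : IsFactorSystem (sectionAct σ) (sectionCocycle σ))

/-- The equivalence `(n, g) ↦ ι(n) σ(g)` from the twisted product of the factor system of a
section `σ` to the given extension. -/
noncomputable def sectionEquiv : (TwistedProduct.extension h).Equiv ext :=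
  .ofMonoidHom
    (MonoidHom.mk' (fun a : TwistedProduct h => ext.inl a.fst * σ a.snd) fun a b => by
      simp [TwistedProduct.mul_def, inl_sectionAct, inl_sectionCocycle, mul_assoc])
    (by
      have hσ : σ 1 = 1 := by simpa [h.left_one] using (inl_sectionCocycle σ 1 1).symm
      ext n
      simp [TwistedProduct.extension, hσ])
    (by
      ext a
      simp [TwistedProduct.extension])

theorem sectionEquiv_apply (a : TwistedProduct h) :
    sectionEquiv σ h a = ext.inl a.fst * σ a.snd := rfl

theorem sectionEquiv_symm_snd (y : H) : ((sectionEquiv σ h).symm y).snd = ext.rightHom y :=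
  (sectionEquiv σ h).symm.rightHom_map y

theorem inl_sectionEquiv_symm_fst (y : H) :
    ext.inl ((sectionEquiv σ h).symm y).fst = y * (σ (ext.rightHom y))⁻¹ := by
  rw [← sectionEquiv_symm_snd σ h, eq_mul_inv_iff_mul_eq, ← sectionEquiv_apply]
  exact (sectionEquiv σ h).toMulEquiv.apply_symm_apply y

end SectionCocycle

namespace IsLieExtension

variable {𝕜 EN EH EG : Type*} [RCLike 𝕜]
  [AddCommGroup EN] [Module 𝕜 EN] [TopologicalSpace EN] [LocallyConvexTVS 𝕜 EN]
  [AddCommGroup EH] [Module 𝕜 EH] [TopologicalSpace EH] [LocallyConvexTVS 𝕜 EH]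
  [AddCommGroup EG] [Module 𝕜 EG] [TopologicalSpace EG] [LocallyConvexTVS 𝕜 EG]
  {N H G : Type*} [Group N] [TopologicalSpace N] [ChartedSpace EN N] [LieGrp 𝕜 EN N]
  [Group H] [TopologicalSpace H] [ChartedSpace EH H] [LieGrp 𝕜 EH H]
  [Group G] [TopologicalSpace G] [ChartedSpace EG G]
  {ext : GroupExtension N H G} {σ : ext.Section}

theorem isC1sAut_sectionAct [SmoothManifold 𝕜 EG G] (hext : IsLieExtension 𝕜 EN EH EG ext)
    (hσ : IsC1s 𝕜 EG EH σ) : IsC1sAut 𝕜 EG EN (sectionAct σ) := by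
  obtain ⟨hσ_one, U, hU, h1U, hσU⟩ := hσ
  refine ⟨fun g => ⟨?_, ?_⟩, by simp [sectionAct, hσ_one], U, hU, h1U, ?_⟩
  · refine mSmooth_of_forall_mSmoothAt fun n => hext.mSmoothAt_of_inl ?_
    simp only [inl_sectionAct]
    exact ((mSmoothAt_const _ _).mul (hext.smooth_inl.mSmoothAt n)).mul (mSmoothAt_const _ _)
  · refine mSmooth_of_forall_mSmoothAt fun n => hext.mSmoothAt_of_inl ?_
    simp only [inl_sectionAct_symm]
    exact ((mSmoothAt_const _ _).mul (hext.smooth_inl.mSmoothAt n)).mul (mSmoothAt_const _ _)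
  · refine mSmoothOn_of_forall_mSmoothAt fun p hp => hext.mSmoothAt_of_inl ?_
    simp only [inl_sectionAct]
    have hσ_fst : MSmoothAt 𝕜 (EG × EN) EH (fun p : G × N => σ p.1) p :=
      (hσU.mSmoothAt hU hp.1).comp_of_eq (mSmoothAt_fst p) rfl
    exact (hσ_fst.mul (hext.smooth_inl.comp_mSmoothAt (mSmoothAt_snd p))).mul hσ_fst.inv

variable [LieGrp 𝕜 EG G]

theorem mSmoothAt_sectionCocycle (hext : IsLieExtension 𝕜 EN EH EG ext)
    (hσ : MSmoothAt 𝕜 EG EH σ 1) :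
    MSmoothAt 𝕜 (EG × EG) EN (fun p : G × G => sectionCocycle σ p.1 p.2) 1 := by
  refine hext.mSmoothAt_of_inl ?_
  simp only [inl_sectionCocycle]
  exact ((hσ.comp_of_eq (mSmoothAt_fst 1) rfl).mul (hσ.comp_of_eq (mSmoothAt_snd 1) rfl)).mul
    (hσ.comp_of_eq ((mSmoothAt_fst 1).mul (mSmoothAt_snd 1)) (mul_one 1)).inv

theorem mSmoothAt_sectionCocycle_conj (hext : IsLieExtension 𝕜 EN EH EG ext)
    (hσ : MSmoothAt 𝕜 EG EH σ 1) (g : G) :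
    MSmoothAt 𝕜 EG EN
      (fun x => sectionCocycle σ g x * (sectionCocycle σ (g * x * g⁻¹) g)⁻¹) 1 := by
  have hinl : ∀ x, ext.inl (sectionCocycle σ g x * (sectionCocycle σ (g * x * g⁻¹) g)⁻¹) =
      σ g * σ x * (σ g)⁻¹ * (σ (g * x * g⁻¹))⁻¹ := fun x => by
    simp [inl_sectionCocycle, mul_assoc]
  have hconj : MSmoothAt 𝕜 EG EG (fun x => g * x * g⁻¹) 1 :=
    ((mSmoothAt_const _ _).mul (mSmoothAt_id 1)).mul (mSmoothAt_const _ _)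
  refine hext.mSmoothAt_of_inl ?_
  simp only [hinl]
  exact (((mSmoothAt_const _ _).mul hσ).mul (mSmoothAt_const _ _)).mul
    (hσ.comp_of_eq hconj (by simp)).inv

theorem isSmoothFactorSystem (hext : IsLieExtension 𝕜 EN EH EG ext) (hσ : IsC1s 𝕜 EG EH σ) :
    IsSmoothFactorSystem 𝕜 EG EN (sectionAct σ) (sectionCocycle σ) :=
  have h := isFactorSystem_section σ hσ.1
  { h with
    isC1sAut := hext.isC1sAut_sectionAct hσ
    isC2ss := ⟨⟨h.right_one, h.left_one, hext.mSmoothAt_sectionCocycle hσ.2⟩,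
      hext.mSmoothAt_sectionCocycle_conj hσ.2⟩ }

end IsLieExtension

section Cochains

variable {𝕜 EN EG : Type*} [RCLike 𝕜]
  [AddCommGroup EN] [Module 𝕜 EN] [TopologicalSpace EN]
  [AddCommGroup EG] [Module 𝕜 EG] [TopologicalSpace EG]
  {N G : Type*} [Group N] [TopologicalSpace N] [ChartedSpace EN N]
  [Group G] [TopologicalSpace G] [ChartedSpace EG G]
  {S : G → MulAut N} {ω : G → G → N}

theorem IsC1sAut.mSmoothAt (hS : IsC1sAut 𝕜 EG EN S) (n : N) :
    MSmoothAt 𝕜 (EG × EN) EN (fun p : G × N => S p.1 p.2) (1, n) :=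
  let ⟨_, _, _, hU, h1U, hSU⟩ := hS
  hSU.mSmoothAt (hU.prod isOpen_univ) ⟨h1U, mem_univ n⟩

theorem IsC2ss.mSmoothAt (hω : IsC2ss 𝕜 EG EN ω) :
    MSmoothAt 𝕜 (EG × EG) EN (fun p : G × G => ω p.1 p.2) 1 :=
  hω.1.2.2

theorem IsC2ss.mSmoothAt_conj (hω : IsC2ss 𝕜 EG EN ω) (c : G) :
    MSmoothAt 𝕜 EG EN (fun x => ω c x * (ω (c * x * c⁻¹) c)⁻¹) 1 :=
  hω.2 c

end Cochains

namespace TwistedProduct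

section Algebra

variable {N G : Type*} [Group N] [Group G] {S : G → MulAut N} {ω : G → G → N}
  (h : IsFactorSystem S ω)

/-- The identity map `N ×_(S,ω) G → N × G`, inverse to `ofProd`. -/
def prodEquiv : TwistedProduct h ≃ N × G where
  toFun a := (a.fst, a.snd)
  invFun := ofProd h
  left_inv _ := rfl
  right_inv _ := rfl

theorem coe_prodEquiv_symm : ⇑(prodEquiv h).symm = ofProd h := rfl

theorem prodEquiv_one : prodEquiv h 1 = 1 := rfl

theorem prodEquiv_symm_one : (prodEquiv h).symm 1 = 1 := rfl

theorem inl_mul_ofProd (n : N) (g : G) :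
    (extension h).inl n * ofProd h (1, g) = ofProd h (n, g) := by
  ext <;> simp [extension, ofProd, mul_def, h.left_one]

theorem inl_fst_eq_mul_inv (a : TwistedProduct h) :
    (extension h).inl a.fst = a * (ofProd h (1, a.snd))⁻¹ :=
  eq_mul_inv_of_mul_eq (inl_mul_ofProd h a.fst a.snd)

theorem conj_inl (m : N) (p : N × G) :
    (extension h).inl m * ofProd h p * ((extension h).inl m)⁻¹ =
      ofProd h (m * p.1 * S p.2 m⁻¹, p.2) := by
  rw [← map_inv]
  ext <;> simp [extension, ofProd, mul_def, h.map_one, h.left_one, h.right_one]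

theorem conj_ofProd_one (c : G) (p : N × G) :
    ofProd h (1, c) * ofProd h p * (ofProd h (1, c))⁻¹ =
      ofProd h (S c p.1 * (ω c p.2 * (ω (c * p.2 * c⁻¹) c)⁻¹), c * p.2 * c⁻¹) := by
  rw [mul_inv_eq_iff_eq_mul]
  ext <;> simp [ofProd, mul_def, mul_assoc]

theorem image_ofProd (U : Set G) :
    ofProd h '' (univ ×ˢ U) = (extension h).rightHom ⁻¹' U := by
  ext x
  constructor
  · rintro ⟨p, hp, rfl⟩
    exact hp.2
  · exact fun hx => ⟨(x.fst, x.snd), ⟨mem_univ _, hx⟩, rfl⟩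

end Algebra

/-- A Lie group structure on `N ×_(S,ω) G` for which the identity map between `N × G` and
`N ×_(S,ω) G` is smooth at `1` in both directions. This is the germ at `1` of
`IsDiffeoOnStrip`. -/
def IsDiffeoAtOne (EN EG : Type*) {𝕜 E G N : Type*} [RCLike 𝕜]
    [AddCommGroup E] [Module 𝕜 E] [TopologicalSpace E] [LocallyConvexTVS 𝕜 E]
    [AddCommGroup EG] [Module 𝕜 EG] [TopologicalSpace EG]
    [AddCommGroup EN] [Module 𝕜 EN] [TopologicalSpace EN]
    [Group G] [TopologicalSpace G] [ChartedSpace EG G]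
    [Group N] [TopologicalSpace N] [ChartedSpace EN N]
    {S : G → MulAut N} {ω : G → G → N} {h : IsFactorSystem S ω}
    (L : LieGrpStructure 𝕜 E (TwistedProduct h)) : Prop :=
  MSmoothAt 𝕜 (EN × EG) E (tM' := L.top) (cM' := L.charts) (prodEquiv h).symm 1 ∧
    MSmoothAt 𝕜 E (EN × EG) (tM := L.top) (cM := L.charts) (prodEquiv h) 1

section Existence

variable {𝕜 EN EG : Type*} [RCLike 𝕜]
  [AddCommGroup EN] [Module 𝕜 EN] [TopologicalSpace EN] [LocallyConvexTVS 𝕜 EN]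
  [AddCommGroup EG] [Module 𝕜 EG] [TopologicalSpace EG] [LocallyConvexTVS 𝕜 EG]
  {N G : Type*} [Group N] [TopologicalSpace N] [ChartedSpace EN N] [LieGrp 𝕜 EN N]
  [Group G] [TopologicalSpace G] [ChartedSpace EG G] [LieGrp 𝕜 EG G]
  {S : G → MulAut N} {ω : G → G → N} (h : IsFactorSystem S ω)

theorem mSmoothAt_mul (hS : IsC1sAut 𝕜 EG EN S) (hω : IsC2ss 𝕜 EG EN ω) :
    MSmoothAt 𝕜 ((EN × EG) × EN × EG) (EN × EG) (fun p : (N × G) × N × G =>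
      prodEquiv h ((prodEquiv h).symm p.1 * (prodEquiv h).symm p.2)) (1, 1) := by
  have hp : MSmoothAt 𝕜 ((EN × EG) × EN × EG) (EN × EG) (fun p : (N × G) × N × G => p.1) (1, 1) :=
    mSmoothAt_fst _
  have hp' : MSmoothAt 𝕜 ((EN × EG) × EN × EG) (EN × EG) (fun p : (N × G) × N × G => p.2) (1, 1) :=
    mSmoothAt_snd _
  have hn := (mSmoothAt_fst (1 : N × G)).comp_of_eq hp rfl
  have hg := (mSmoothAt_snd (1 : N × G)).comp_of_eq hp rfl
  have hn' := (mSmoothAt_fst (1 : N × G)).comp_of_eq hp' rfl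
  have hg' := (mSmoothAt_snd (1 : N × G)).comp_of_eq hp' rfl
  exact ((hn.mul ((hS.mSmoothAt 1).comp_of_eq (hg.prodMk hn') rfl)).mul
    (hω.mSmoothAt.comp_of_eq (hg.prodMk hg') rfl)).prodMk (hg.mul hg')

theorem mSmoothAt_inv (hS : IsC1sAut 𝕜 EG EN S) (hω : IsC2ss 𝕜 EG EN ω) :
    MSmoothAt 𝕜 (EN × EG) (EN × EG) (fun p : N × G => prodEquiv h ((prodEquiv h).symm p)⁻¹) 1 := by
  have hn : MSmoothAt 𝕜 (EN × EG) EN (fun p : N × G => p.1) 1 := mSmoothAt_fst 1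
  have hg : MSmoothAt 𝕜 (EN × EG) EG (fun p : N × G => p.2) 1 := mSmoothAt_snd 1
  exact ((hω.mSmoothAt.comp_of_eq (hg.inv.prodMk hg) (by ext <;> simp)).inv.mul
    ((hS.mSmoothAt 1).comp_of_eq (hg.inv.prodMk hn.inv) (by simp))).prodMk hg.inv

theorem mSmoothAt_conj_inl (hS : IsC1sAut 𝕜 EG EN S) (m : N) :
    MSmoothAt 𝕜 (EN × EG) (EN × EG) (fun p : N × G =>
      prodEquiv h ((extension h).inl m * (prodEquiv h).symm p * ((extension h).inl m)⁻¹)) 1 := by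
  simp only [coe_prodEquiv_symm, conj_inl]
  exact (((mSmoothAt_const m 1).mul (mSmoothAt_fst 1)).mul ((hS.mSmoothAt m⁻¹).comp_of_eq
    ((mSmoothAt_snd 1).prodMk (mSmoothAt_const m⁻¹ 1)) rfl)).prodMk (mSmoothAt_snd 1)

theorem mSmoothAt_conj_ofProd_one (hS : IsC1sAut 𝕜 EG EN S) (hω : IsC2ss 𝕜 EG EN ω) (c : G) :
    MSmoothAt 𝕜 (EN × EG) (EN × EG) (fun p : N × G =>
      prodEquiv h (ofProd h (1, c) * (prodEquiv h).symm p * (ofProd h (1, c))⁻¹)) 1 := by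
  simp only [coe_prodEquiv_symm, conj_ofProd_one]
  exact (((hS.1 c).1.comp_mSmoothAt (mSmoothAt_fst 1)).mul
    ((hω.mSmoothAt_conj c).comp_of_eq (mSmoothAt_snd 1) rfl)).prodMk
    (((mSmoothAt_const c 1).mul (mSmoothAt_snd 1)).mul (mSmoothAt_const c⁻¹ 1))

theorem mSmoothAt_conj (hS : IsC1sAut 𝕜 EG EN S) (hω : IsC2ss 𝕜 EG EN ω)
    (a : TwistedProduct h) :
    MSmoothAt 𝕜 (EN × EG) (EN × EG) (fun p : N × G =>
      prodEquiv h (a * (prodEquiv h).symm p * a⁻¹)) 1 := by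
  have hconj := (mSmoothAt_conj_inl h hS a.fst).comp_of_eq
    (mSmoothAt_conj_ofProd_one h hS hω a.snd) (by rw [prodEquiv_symm_one]; simp [prodEquiv_one])
  have ha : (extension h).inl a.fst * ofProd h (1, a.snd) = a := inl_mul_ofProd h _ _
  rw [← ha]
  simpa only [Equiv.symm_apply_apply, mul_inv_rev, mul_assoc] using hconj

theorem exists_isDiffeoAtOne (hS : IsC1sAut 𝕜 EG EN S) (hω : IsC2ss 𝕜 EG EN ω) :
    ∃ L : LieGrpStructure 𝕜 (EN × EG) (TwistedProduct h), IsDiffeoAtOne EN EG L :=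
  let ⟨L, hL, hL_symm⟩ := exists_lieGrpStructure_of_mSmoothAt (φ := prodEquiv h)
    (mSmoothAt_mul h hS hω) (mSmoothAt_inv h hS hω) (mSmoothAt_conj h hS hω)
  ⟨L, hL_symm, hL⟩

end Existence

section Structures

variable {𝕜 EN EG E E' : Type*} [RCLike 𝕜]
  [AddCommGroup EN] [Module 𝕜 EN] [TopologicalSpace EN]
  [AddCommGroup EG] [Module 𝕜 EG] [TopologicalSpace EG]
  [AddCommGroup E] [Module 𝕜 E] [TopologicalSpace E] [LocallyConvexTVS 𝕜 E]
  [AddCommGroup E'] [Module 𝕜 E'] [TopologicalSpace E'] [LocallyConvexTVS 𝕜 E']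
  {N G : Type*} [Group N] [TopologicalSpace N] [ChartedSpace EN N]
  [Group G] [TopologicalSpace G] [ChartedSpace EG G]
  {S : G → MulAut N} {ω : G → G → N} {h : IsFactorSystem S ω}
  {L : LieGrpStructure 𝕜 E (TwistedProduct h)} {L' : LieGrpStructure 𝕜 E' (TwistedProduct h)}

theorem IsDiffeoAtOne.of_isDiffeoOnStrip (hL : IsDiffeoOnStrip EN EG L) :
    IsDiffeoAtOne EN EG L := by
  let := L.top
  let := L.charts
  obtain ⟨U, -, h1U, hopen, himage, hsmooth, r, hr, hr_smooth⟩ := hL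
  have hmem : (1 : N × G) ∈ (univ : Set N) ×ˢ U := ⟨mem_univ 1, h1U⟩
  have hmem_image : (1 : TwistedProduct h) ∈ ofProd h '' (univ ×ˢ U) := ⟨1, hmem, rfl⟩
  refine ⟨hsmooth.mSmoothAt hopen hmem,
    (hr_smooth.mSmoothAt himage hmem_image).congr_of_eventuallyEq ?_⟩
  filter_upwards [himage.mem_nhds hmem_image]
  rintro _ ⟨p, hp, rfl⟩
  exact hr hp

variable [LocallyConvexTVS 𝕜 EN] [LocallyConvexTVS 𝕜 EG]

theorem IsDiffeoAtOne.mSmooth_of_comp {X : Type*} [Group X] [TopologicalSpace X]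
    [ChartedSpace E' X] [LieGrp 𝕜 E' X] (hL : IsDiffeoAtOne EN EG L) (φ : TwistedProduct h →* X)
    (hφ : MSmoothAt 𝕜 (EN × EG) E' (fun p => φ (ofProd h p)) 1) :
    MSmooth 𝕜 E E' (tM := L.top) (cM := L.charts) φ := by
  let := L.top
  let := L.charts
  have := L.lieGrp
  exact mSmooth_of_mSmoothAt_one φ (hφ.comp_of_eq hL.2 rfl)

theorem IsDiffeoAtOne.same (hL : IsDiffeoAtOne EN EG L) (hL' : IsDiffeoAtOne EN EG L') :
    L.Same L' := by
  constructor
  · let := L'.top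
    let := L'.charts
    have := L'.lieGrp
    exact hL.mSmooth_of_comp (MonoidHom.id _) hL'.1
  · let := L.top
    let := L.charts
    have := L.lieGrp
    exact hL'.mSmooth_of_comp (MonoidHom.id _) hL.1

theorem IsDiffeoAtOne.mSmoothAt_ofProd_one [SmoothManifold 𝕜 EG G]
    (hL : IsDiffeoAtOne EN EG L) :
    MSmoothAt 𝕜 EG E (tM' := L.top) (cM' := L.charts) (fun g => ofProd h (1, g)) 1 := by
  let := L.top
  let := L.charts
  have := L.lieGrp
  exact hL.1.comp_of_eq ((mSmoothAt_const 1 1).prodMk (mSmoothAt_id 1)) rfl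

variable [LieGrp 𝕜 EN N]

theorem isDiffeoOnStrip_of_isSmoothOnStrip (hL : IsSmoothOnStrip EN EG L)
    (hext : IsExtensionWith EN EG L) : IsDiffeoOnStrip EN EG L := by
  let := L.top
  let := L.charts
  have := L.lieGrp
  obtain ⟨U, hU, h1U, hsmooth⟩ := hL
  have hopen := (isOpen_univ (X := N)).prod hU
  refine ⟨U, hU, h1U, hopen, ?_, hsmooth, prodEquiv h, fun _ _ => rfl, ?_⟩ <;>
    rw [image_ofProd]
  · exact hU.preimage hext.smooth_rightHom.continuous
  · refine mSmoothOn_of_forall_mSmoothAt fun x hx => ?_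
    have hsnd : MSmoothAt 𝕜 E EG TwistedProduct.snd x := hext.smooth_rightHom.mSmoothAt x
    have hmem : ((1, x.snd) : N × G) ∈ univ ×ˢ U := ⟨mem_univ _, hx⟩
    have hσ : MSmoothAt 𝕜 E E (fun x : TwistedProduct h => ofProd h (1, x.snd)) x :=
      (hsmooth.mSmoothAt hopen hmem).comp_of_eq ((mSmoothAt_const 1 x).prodMk hsnd) rfl
    refine .prodMk (hext.mSmoothAt_of_inl ?_) hsnd
    simp only [inl_fst_eq_mul_inv]
    exact (mSmoothAt_id x).mul hσ.inv

theorem lieEquivalent_of_isDiffeoAtOne [SmoothManifold 𝕜 EG G]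
    {H : Type*} [Group H] [TopologicalSpace H] [ChartedSpace E' H] [LieGrp 𝕜 E' H]
    {ext : GroupExtension N H G}
    (hext : IsLieExtension 𝕜 EN E' EG ext) {σ : ext.Section} (hσ : MSmoothAt 𝕜 EG E' σ 1)
    {h : IsFactorSystem (sectionAct σ) (sectionCocycle σ)}
    {L : LieGrpStructure 𝕜 E (TwistedProduct h)} (hL : IsDiffeoAtOne EN EG L) :
    LieEquivalent 𝕜 E' E (tH' := L.top) (cH' := L.charts) ext (extension h) := by
  refine ⟨(sectionEquiv σ h).symm, ?_,
    hL.mSmooth_of_comp (sectionEquiv σ h).toMulEquiv.toMonoidHom <|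
      (hext.smooth_inl.comp_mSmoothAt (mSmoothAt_fst 1)).mul
        (hσ.comp_of_eq (mSmoothAt_snd 1) rfl)⟩
  let := L.top
  let := L.charts
  have := L.lieGrp
  have hsnd : MSmoothAt 𝕜 E' EG (fun y => ((sectionEquiv σ h).symm y).snd) 1 := by
    simpa only [sectionEquiv_symm_snd] using hext.smooth_rightHom.mSmoothAt 1
  have hfst : MSmoothAt 𝕜 E' EN (fun y => ((sectionEquiv σ h).symm y).fst) 1 := by
    refine hext.mSmoothAt_of_inl ?_
    simp only [inl_sectionEquiv_symm_fst]
    exact (mSmoothAt_id 1).mul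
      (hσ.comp_of_eq (hext.smooth_rightHom.mSmoothAt 1) (map_one _)).inv
  exact mSmooth_of_mSmoothAt_one (sectionEquiv σ h).symm.toMulEquiv.toMonoidHom
    (hL.1.comp_of_eq (hfst.prodMk hsnd) (congrArg (prodEquiv h) (map_one _)))

variable [LieGrp 𝕜 EG G]

theorem IsDiffeoAtOne.isExtensionWith (hL : IsDiffeoAtOne EN EG L) : IsExtensionWith EN EG L := by
  let := L.top
  let := L.charts
  have := L.lieGrp
  let σ : (extension h).Section := ⟨fun g => ofProd h (1, g), fun _ => rfl⟩
  exact .of_section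
    (mSmooth_of_mSmoothAt_one _
      (hL.1.comp_of_eq ((mSmoothAt_id 1).prodMk (mSmoothAt_const 1 1)) rfl))
    (mSmooth_of_mSmoothAt_one _ ((mSmoothAt_snd _).comp_of_eq hL.2 rfl))
    (r := TwistedProduct.fst) (fun _ => rfl) ((mSmoothAt_fst _).comp_of_eq hL.2 rfl)
    (σ := σ) hL.mSmoothAt_ofProd_one

theorem IsDiffeoAtOne.isSmoothOnStrip (hL : IsDiffeoAtOne EN EG L) : IsSmoothOnStrip EN EG L := by
  let := L.top
  let := L.charts
  have := L.lieGrp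
  obtain ⟨U, hU, h1U, hσ⟩ := hL.mSmoothAt_ofProd_one
  refine ⟨U, hU, h1U, mSmoothOn_of_forall_mSmoothAt fun p hp => ?_⟩
  simpa only [inl_mul_ofProd] using
    (hL.isExtensionWith.smooth_inl.comp_mSmoothAt (mSmoothAt_fst p)).mul
    ((hσ.mSmoothAt hU hp.2).comp_of_eq (mSmoothAt_snd p) rfl)

end Structures

end TwistedProduct

end LCLie

theorem mainTheorem3 {𝕜 : Type*} [RCLike 𝕜]
    {EN EG : Type*}
    [AddCommGroup EN] [Module 𝕜 EN] [TopologicalSpace EN] [LocallyConvexTVS 𝕜 EN]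
    [AddCommGroup EG] [Module 𝕜 EG] [TopologicalSpace EG] [LocallyConvexTVS 𝕜 EG]
    {N G : Type*}
    [Group N] [TopologicalSpace N] [ChartedSpace EN N] [LieGrp 𝕜 EN N]
    [Group G] [TopologicalSpace G] [ChartedSpace EG G] [LieGrp 𝕜 EG G] :
    -- the Lie group structure on `N ×_(S,ω) G`: existence, extension property, uniqueness
    (∀ (S : G → MulAut N) (ω : G → G → N) (h : IsSmoothFactorSystem 𝕜 EG EN S ω),
      ∃ L : LieGrpStructure 𝕜 (EN × EG) (TwistedProduct h.toIsFactorSystem),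
        IsDiffeoOnStrip EN EG L ∧
        IsExtensionWith EN EG L ∧
        ∀ {E : Type*} [AddCommGroup E] [Module 𝕜 E] [TopologicalSpace E] [LocallyConvexTVS 𝕜 E]
          (L' : LieGrpStructure 𝕜 E (TwistedProduct h.toIsFactorSystem)),
          (IsDiffeoOnStrip EN EG L' ∨ (IsSmoothOnStrip EN EG L' ∧ IsExtensionWith EN EG L')) →
            L.Same L') ∧
    -- every extension arises in this way
    (∀ {EH H : Type*}
      [AddCommGroup EH] [Module 𝕜 EH] [TopologicalSpace EH] [LocallyConvexTVS 𝕜 EH]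
      [Group H] [TopologicalSpace H] [ChartedSpace EH H] [LieGrp 𝕜 EH H]
      (ext : GroupExtension N H G), IsLieExtension 𝕜 EN EH EG ext →
        (∃ σ : ext.Section, IsC1s 𝕜 EG EH σ) ∧
        ∀ σ : ext.Section, IsC1s 𝕜 EG EH σ →
          ∃ h : IsSmoothFactorSystem 𝕜 EG EN (sectionAct σ) (sectionCocycle σ),
            ∀ L : LieGrpStructure 𝕜 (EN × EG) (TwistedProduct h.toIsFactorSystem),
              IsDiffeoOnStrip EN EG L →
                LieEquivalent 𝕜 EH (EN × EG) (tH' := L.top) (cH' := L.charts)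
                  ext (TwistedProduct.extension h.toIsFactorSystem)) := by
  refine ⟨fun S ω h => ?_, fun ext hext => ⟨hext.exists_section, fun σ hσ => ?_⟩⟩
  · obtain ⟨L, hL⟩ :=
      TwistedProduct.exists_isDiffeoAtOne h.toIsFactorSystem h.isC1sAut h.isC2ss
    have hL_ext := hL.isExtensionWith
    refine ⟨L, TwistedProduct.isDiffeoOnStrip_of_isSmoothOnStrip hL.isSmoothOnStrip hL_ext, hL_ext,
      fun L' hL' => hL.same (.of_isDiffeoOnStrip ?_)⟩
    rcases hL' with hL'_diffeo | ⟨hL'_smooth, hL'_ext⟩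
    · exact hL'_diffeo
    · exact TwistedProduct.isDiffeoOnStrip_of_isSmoothOnStrip hL'_smooth hL'_ext
  · exact ⟨hext.isSmoothFactorSystem hσ, fun L hL =>
      TwistedProduct.lieEquivalent_of_isDiffeoAtOne hext hσ.2 (.of_isDiffeoOnStrip hL)⟩
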